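/- **Definitions.** A *neighborhood* is a finite set $N\subset\mathbb Z^2$ with $(0,0)\notin N$ and $-w\in N$ for all $w\in N$; the von Neumann neighborhood is $N_{vN}=\{(0,1),(1,0),(0,-1),(-1,0)\}$. Given a finite set $X$ of glues, a *tile* in neighborhood $N$ is a family $t=(t_w)_{w\in N}$ of elements of $X$, and a *tile system* is a finite set of tiles. A $(T,N)$-*tiling* is a map $\tau:D\to T$ with $D=\operatorname{dom}\tau\subseteq\mathbb Z^2$ such that $\tau(p)_w=\tau(p+w)_{-w}$ whenever $w\in N$ and $p,p+w\in D$. It is *total* if $D=\mathbb Z^2$, and it is a *polyomino* if $D$ is finite and 4-connected; a polyomino is *filled in* if it has no holes, i.e. $\mathbb Z^2\setminus D$ is 4-connected. Let $\mathfrak T_{T,N}$ be the set of all $(T,N)$-tilings. A *poly-tiling* of scale $s$ using $T'$ in neighborhood $N'$ is a map $P$ from a set $D\subseteq\mathbb Z^2$ to the finite $(T',N')$-tilings such that the sets $\operatorname{dom}(P(u))+su$ ($u\in D$) are pairwise disjoint and $P(u)(v)_w=P(u')(v')_{-w}$ whenever $u,u'\in D$, $v\in\operatorname{dom}P(u)$,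 $v'\in\operatorname{dom}P(u')$ and $w=(su'+v')-(su+v)\in N'$. It is identified with the $(T',N')$-tiling whose tile at position $su+v$ is $P(u)(v)$. A *tiling-simulation* $\psi$ of a tile system $T$ (in neighborhood $N$) by a tile system $T'$ (in neighborhood $N'$) is given by an integer $s\ge 1$, a function $\varphi$ and a map $\psi$ as follows. * $\varphi$ associates with each $t\in T$ a set $\varphi(t)$ of finite $(T',N')$-tilings, all having $(0,0)$ in their domain, and such that for $t\neq t'$ no tile of $T'$ occurs both in an element of $\varphi(t)$ and in an element of $\varphi(t')$. Let $\chi_\varphi:\mathfrak T_{T',N'}\to\mathfrak T_{T',N'}$ be the map that first discards all the tiles that do not belong to a complete translated copy of an element of some $\varphi(t)$, and then all the tiles that do not belong to such a copy whose origin is placed at a point of $s\mathbb Z^2$. * $\psi$ associates with every $(T,N)$-tiling $\tau:D\to T$ a non-empty subset $\psi(\tau)$ of $\chi_\varphi(\mathfrak T_{T',N'})$, every element of which is (the tiling given by) a poly-tiling $P$ of scale $s$ with domain $D$ and $P(u)\in\varphi(\tau(u))$ for all $u\in D$. * For every $(T',N')$-tiling $\tau'$ there is exactly one $(T,N)$-tiling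 $\tau$ such that $\chi_\varphi(\tau')\in\psi(\tau)$. **Theorem.** Let $T$ be a tile system in an arbitrary neighborhood $N$, with a finite set of glues $X$. There exist a finite set of glues $X_\mu$, a tile system $T_\mu$ in neighborhood $N_{vN}$ with glues in $X_\mu$, and a tiling-simulation $\psi$ of $T$ by $T_\mu$, in which all elements of all the sets $\varphi(t)$, $t\in T$, are filled-in polyominoes, such that for every $(T,N)$-tiling $\tau$: 1. $\tau$ is total if and only if all $(T_\mu,N_{vN})$-tilings in $\psi(\tau)$ are total; 2. if $\tau$ is total, then $\psi(\tau)$ is a singleton. -/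

import Mathlib

namespace NbhdTiling

/-- A neighborhood: a finite symmetric set of nonzero relative positions. -/
structure Neighborhood where
  carrier : Finset (ℤ × ℤ)
  zero_notMem : (0, 0) ∉ carrier
  neg_mem : ∀ w ∈ carrier, -w ∈ carrier

/-- The von Neumann neighborhood. -/
def vonNeumann : Neighborhood where
  carrier := {(0, 1), (1, 0), (0, -1), (-1, 0)}
  zero_notMem := by decide
  neg_mem := by decide

/-- The opposite of a relative position. -/
def Neighborhood.opp (N : Neighborhood) (w : {w // w ∈ N.carrier}) : {w // w ∈ N.carrier} :=
  ⟨-w.1, N.neg_mem w.1 w.2⟩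

/-- A tile in neighborhood `N` with glues in `X`: one glue for each position in `N`. -/
abbrev Tile (N : Neighborhood) (X : Type*) : Type _ := {w // w ∈ N.carrier} → X

/-- `t` sticks to a tile `t'` placed at position `w` relative to `t`. -/
def Sticks {N : Neighborhood} {X : Type*} (t t' : Tile N X) (w : {w // w ∈ N.carrier}) : Prop :=
  t w = t' (N.opp w)

/-- A `(T, N)`-tiling `D → T` with `D ⊆ ℤ²`; the value `none` stands for the positions
outside the domain `D`. -/
@[ext]
structure Tiling {N : Neighborhood} {X : Type*} (T : Finset (Tile N X)) where
  toFun : ℤ × ℤ → Option {t // t ∈ T}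
  sticks : ∀ (p : ℤ × ℤ) (w : {w // w ∈ N.carrier}) (t t' : {t // t ∈ T}),
    toFun p = some t → toFun (p + w.1) = some t' → Sticks t.1 t'.1 w

/-- A set of positions is 4-connected: any two of its points are joined by a path of
von Neumann-adjacent positions inside the set. -/
def Connected4 (A : Set (ℤ × ℤ)) : Prop :=
  ∀ p ∈ A, ∀ q ∈ A,
    Relation.ReflTransGen (fun a b => a ∈ A ∧ b ∈ A ∧ b - a ∈ vonNeumann.carrier) p q

namespace Tiling

variable {N : Neighborhood} {X : Type*} {T : Finset (Tile N X)}

/-- The domain of a tiling. -/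
def dom (τ : Tiling T) : Set (ℤ × ℤ) := {p | ∃ t, τ.toFun p = some t}

/-- A tiling is total if its domain is the whole plane. -/
def IsTotal (τ : Tiling T) : Prop := τ.dom = Set.univ

/-- A polyomino: a finite connected tiling. -/
def IsPolyomino (τ : Tiling T) : Prop := τ.dom.Finite ∧ Connected4 τ.dom

/-- A polyomino without holes. -/
def IsFilledPolyomino (τ : Tiling T) : Prop := τ.IsPolyomino ∧ Connected4 τ.domᶜ

open Classical in
/-- The restriction of a tiling to the positions of its domain that lie in `A`. -/
noncomputable def restrict (τ : Tiling T) (A : Set (ℤ × ℤ)) : Tiling T where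
  toFun p := if p ∈ A then τ.toFun p else none
  sticks := by
    intro p w t t' h h'
    split_ifs at h h'
    exact τ.sticks p w t t' h h'

/-- The tiling `τ` contains a complete copy of `π`, with the origin of `π` at position `q`. -/
def ContainsAt (τ π : Tiling T) (q : ℤ × ℤ) : Prop :=
  ∀ v t, π.toFun v = some t → τ.toFun (q + v) = some t

end Tiling

/-- A poly-tiling of scale `s`: a map `D → {(T, N)-tilings}` with `D ⊆ ℤ²`
(`none` outside `D`), such that the tilings in its range are finite, and such that, once
each of them is shifted by `s • u`, they are disjoint and stick to each other. -/
structure PolyTiling {N : Neighborhood} {X : Type*} (T : Finset (Tile N X)) (s : ℕ) where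
  toFun : ℤ × ℤ → Option (Tiling T)
  finite : ∀ u π, toFun u = some π → π.dom.Finite
  disjoint : ∀ u u' π π', toFun u = some π → toFun u' = some π' → u ≠ u' →
    Disjoint ((fun v => v + (s : ℤ) • u) '' π.dom) ((fun v => v + (s : ℤ) • u') '' π'.dom)
  sticks : ∀ u u' π π', toFun u = some π → toFun u' = some π' →
    ∀ v v' t t', π.toFun v = some t → π'.toFun v' = some t' →
    ∀ w : {w // w ∈ N.carrier}, w.1 = ((s : ℤ) • u' + v') - ((s : ℤ) • u + v) →
    Sticks t.1 t'.1 w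

namespace PolyTiling

variable {N : Neighborhood} {X : Type*} {T : Finset (Tile N X)} {s : ℕ}

open Classical in
/-- A poly-tiling seen as a regular tiling: the tile at position `s • u + v` is the tile at
position `v` of the tiling associated with `u`. -/
noncomputable def flatten (P : PolyTiling T s) : Tiling T where
  toFun p :=
    if h : ∃ t, ∃ u π, P.toFun u = some π ∧ π.toFun (p - (s : ℤ) • u) = some t
    then some h.choose else none
  sticks := by
    intro p w t t' h h'
    split_ifs at h h' with h1 h2
    obtain ⟨u, π, hu, ht⟩ := h1.choose_spec
    obtain ⟨u', π', hu', ht'⟩ := h2.choose_spec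
    rw [Option.some.inj h] at ht
    rw [Option.some.inj h'] at ht'
    exact P.sticks u u' π π' hu hu' _ _ t t' ht ht' w (by abel)

/-- The defining property of `flatten`. -/
theorem flatten_eq_some_iff (P : PolyTiling T s) (p : ℤ × ℤ) (t : {t // t ∈ T}) :
    P.flatten.toFun p = some t ↔
      ∃ u π, P.toFun u = some π ∧ π.toFun (p - (s : ℤ) • u) = some t := by
  constructor
  · intro h
    simp only [flatten] at h
    split_ifs at h with h1
    rw [← Option.some.inj h]
    exact h1.choose_spec
  · rintro ⟨u, π, hu, ht⟩
    have h1 : ∃ t, ∃ u π, P.toFun u = some π ∧ π.toFun (p - (s : ℤ) • u) = some t :=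
      ⟨t, u, π, hu, ht⟩
    simp only [flatten, dif_pos h1]
    obtain ⟨u', π', hu', ht'⟩ := h1.choose_spec
    have huu : u = u' := by
      by_contra hne
      have hd := Set.disjoint_left.1 (P.disjoint u u' π π' hu hu' hne)
      exact @hd p ⟨p - (s : ℤ) • u, ⟨t, ht⟩, by simp⟩ ⟨p - (s : ℤ) • u', ⟨_, ht'⟩, by simp⟩
    subst huu
    rw [hu] at hu'
    obtain rfl := Option.some.inj hu'
    rw [← ht', ht]

end PolyTiling

/-- A function `φ` that replaces every tile of `T` by a set of finite `(T', N')`-tilings, to be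
put on a grid of size `scale`: the origin belongs to each of them, and distinct tiles of `T`
get finite tilings that have no tile of `T'` in common. -/
structure Substitution {N N' : Neighborhood} {X X' : Type*}
    (T : Finset (Tile N X)) (T' : Finset (Tile N' X')) where
  scale : ℕ
  scale_pos : 0 < scale
  φ : {t // t ∈ T} → Set (Tiling T')
  finite : ∀ t, ∀ π ∈ φ t, π.dom.Finite
  reference : ∀ t, ∀ π ∈ φ t, (0, 0) ∈ π.dom
  specific : ∀ t t', t ≠ t' → ∀ π ∈ φ t, ∀ π' ∈ φ t',
    ∀ u u' a a', π.toFun u = some a → π'.toFun u' = some a' → a ≠ a'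

namespace Substitution

variable {N N' : Neighborhood} {X X' : Type*}
  {T : Finset (Tile N X)} {T' : Finset (Tile N' X')}

/-- Discard all the tiles that do not belong to a complete copy of an element of some `φ t`. -/
noncomputable def complete (F : Substitution T T') (τ : Tiling T') : Tiling T' :=
  τ.restrict {p | ∃ t, ∃ π ∈ F.φ t, ∃ q, τ.ContainsAt π q ∧ p - q ∈ π.dom}

/-- Discard all the tiles that do not belong to a complete copy of an element of some `φ t`
whose reference tile is at a point of the grid of size `scale`. -/
noncomputable def aligned (F : Substitution T T') (τ : Tiling T') : Tiling T' :=
  τ.restrict {p | ∃ t, ∃ π ∈ F.φ t, ∃ u : ℤ × ℤ,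
    τ.ContainsAt π ((F.scale : ℤ) • u) ∧ p - (F.scale : ℤ) • u ∈ π.dom}

/-- The map `χ_φ`, which removes incomplete and then misaligned polyominoes. -/
noncomputable def χ (F : Substitution T T') (τ : Tiling T') : Tiling T' :=
  F.aligned (F.complete τ)

/-- The poly-tiling `P` has the same domain as the tiling `τ`, and `P u ∈ φ (τ u)` for every `u`
in this domain. -/
def Replaces (F : Substitution T T') (τ : Tiling T) (P : PolyTiling T' F.scale) : Prop :=
  (∀ u, τ.toFun u = none → P.toFun u = none) ∧
  ∀ u t, τ.toFun u = some t → ∃ π ∈ F.φ t, P.toFun u = some π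

end Substitution

/-- A tiling-simulation of the tile system `T` by the tile system `T'`. -/
structure TilingSimulation {N N' : Neighborhood} {X X' : Type*}
    (T : Finset (Tile N X)) (T' : Finset (Tile N' X')) extends Substitution T T' where
  ψ : Tiling T → Set (Tiling T')
  ψ_subset_range : ∀ τ, ψ τ ⊆ Set.range toSubstitution.χ
  ψ_nonempty : ∀ τ, (ψ τ).Nonempty
  ψ_poly : ∀ τ, ∀ τ' ∈ ψ τ, ∃ P : PolyTiling T' scale,
    toSubstitution.Replaces τ P ∧ P.flatten = τ'
  decode : ∀ τ' : Tiling T', ∃! τ : Tiling T, toSubstitution.χ τ' ∈ ψ τ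

end NbhdTiling

open NbhdTiling

namespace NbhdTiling

/-! The glues of `T` become geometry. The plane is cut into regions, one for each position, whose
boundaries depend on a field of labels on the pairs of neighbors. If two neighbors disagree on the
label of their pair, their regions share a cell (`Layout.spot`), so the polyominoes of two tiles
that do not stick can never coexist, however far apart and whatever lies between them.

For the regions, let m = c² + 1, C u = u.1 + c * u.2 and J u = u.2 - c * u.1. The ribbon of u lies
in the strip J u and fills the m slabs from C u on; the ribbons of a strip follow each other end to
end. For c large, a neighbor w of 0 has J w ≠ 0, and the ribbons of 0 and w have a slab in common,
where (up to exchanging w and -w) w passes J w strips above 0. Each label y of the pair owns a block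
of columns there: if the actual label is not y, the strips above 0 dip until the ribbon of w takes a
cell that 0 otherwise owns (`Ribbons.target_spot`). Ribbons are level sets of a function that is
monotone in every column, hence connected without holes; a map with connected fibers (`CellMap`)
carries this over to regions placed on a square lattice.

A polyomino records all labels known around its position, and each of its microtiles identifies
these labels and its own place (`Layout.micro_inj`). Hence complete aligned copies in any tiling
never overlap, and they decode to a tiling by `T` (`Layout.exists_replaces_flatten_eq_χ`). Adjacent
regions compare their known labels at two doors whose place does not depend on the labels. In a
total tiling this forces all the labels to be those read off the tiles
(`Layout.toFun_eq_of_isTotal`), whence totality and uniqueness. If a position is missing, the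
polyominoes cut out by one common field leave its reference cell empty. -/

theorem mem_vonNeumann {w : ℤ × ℤ} :
    w ∈ vonNeumann.carrier ↔ w = (0, 1) ∨ w = (1, 0) ∨ w = (0, -1) ∨ w = (-1, 0) := by
  simp [vonNeumann]

theorem neg_sub_mem {a b : ℤ × ℤ} (h : b - a ∈ vonNeumann.carrier) :
    a - b ∈ vonNeumann.carrier := by
  rw [← neg_sub]
  exact vonNeumann.neg_mem _ h

/-! ### Paths in the grid -/

/-- `q` can be reached from `p` through von Neumann-adjacent positions of `A`. -/
abbrev Joined (A : Set (ℤ × ℤ)) (p q : ℤ × ℤ) : Prop :=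
  Relation.ReflTransGen (fun a b => a ∈ A ∧ b ∈ A ∧ b - a ∈ vonNeumann.carrier) p q

theorem Joined.symm {A : Set (ℤ × ℤ)} {p q : ℤ × ℤ} (h : Joined A p q) : Joined A q p := by
  induction h with
  | refl => exact .refl
  | tail _ h ih => exact .head ⟨h.2.1, h.1, neg_sub_mem h.2.2⟩ ih

theorem Joined.mono {A B : Set (ℤ × ℤ)} (hAB : A ⊆ B) {p q : ℤ × ℤ} (h : Joined A p q) :
    Joined B p q := by
  induction h with
  | refl => exact .refl
  | tail _ h ih => exact .tail ih ⟨hAB h.1, hAB h.2.1, h.2.2⟩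

theorem joined_step {A : Set (ℤ × ℤ)} {p q : ℤ × ℤ} (hp : p ∈ A) (hq : q ∈ A)
    (h : q - p ∈ vonNeumann.carrier) : Joined A p q :=
  Relation.ReflTransGen.single ⟨hp, hq, h⟩

theorem joined_right {A : Set (ℤ × ℤ)} {x y : ℤ} (hp : (x, y) ∈ A) (hq : (x + 1, y) ∈ A) :
    Joined A (x, y) (x + 1, y) :=
  joined_step hp hq (by rw [mem_vonNeumann]; simp)

theorem joined_up {A : Set (ℤ × ℤ)} {x y : ℤ} (hp : (x, y) ∈ A) (hq : (x, y + 1) ∈ A) :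
    Joined A (x, y) (x, y + 1) :=
  joined_step hp hq (by rw [mem_vonNeumann]; simp)

theorem joined_vertical {A : Set (ℤ × ℤ)} {x y y' : ℤ} (hy : y ≤ y')
    (h : ∀ t, y ≤ t → t ≤ y' → (x, t) ∈ A) : Joined A (x, y) (x, y') := by
  induction y', hy using Int.leInduction with
  | base => exact .refl
  | succ k hk ih =>
    exact (ih fun t h1 h2 => h t h1 (by lia)).trans
      (joined_up (h k hk (by lia)) (h (k + 1) (by lia) le_rfl))

theorem joined_horizontal {A : Set (ℤ × ℤ)} {x x' y : ℤ} (hx : x ≤ x')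
    (h : ∀ t, x ≤ t → t ≤ x' → (t, y) ∈ A) : Joined A (x, y) (x', y) := by
  induction x', hx using Int.leInduction with
  | base => exact .refl
  | succ k hk ih =>
    exact (ih fun t h1 h2 => h t h1 (by lia)).trans
      (joined_right (h k hk (by lia)) (h (k + 1) (by lia) le_rfl))

/-! ### Grid maps with connected fibers -/

/-- A map of the plane that is compatible with 4-connectedness: adjacent positions have
adjacent preimages, and fibers are finite and 4-connected. -/
structure CellMap (f : ℤ × ℤ → ℤ × ℤ) : Prop where
  lift : ∀ a b, b - a ∈ vonNeumann.carrier →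
    ∃ p q, f p = a ∧ f q = b ∧ q - p ∈ vonNeumann.carrier
  fiber : ∀ a, Connected4 (f ⁻¹' {a})
  finite : ∀ a, (f ⁻¹' {a}).Finite

namespace CellMap

variable {f g : ℤ × ℤ → ℤ × ℤ}

/-- A path lifts edge by edge; the end of a lifted edge and the start of the next lie in the same
fiber, where they can be joined. -/
theorem connected_preimage (hf : CellMap f) {A : Set (ℤ × ℤ)} (hA : Connected4 A) :
    Connected4 (f ⁻¹' A) := by
  intro p hp q hq
  have key : ∀ b, Joined A (f p) b → b ∈ A → ∀ q, f q = b → Joined (f ⁻¹' A) p q := by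
    intro b hb
    induction hb with
    | refl =>
      intro hm q hq
      refine Joined.mono ?_ (hf.fiber (f p) p rfl q hq)
      intro x hx
      rw [Set.mem_preimage, hx]
      exact hm
    | tail _ h ih =>
      obtain ⟨h1, h2, h3⟩ := h
      intro hm q hq
      obtain ⟨p', q', rfl, rfl, h⟩ := hf.lift _ _ h3
      refine ((ih h1 p' rfl).trans (joined_step h1 h2 h)).trans
        (Joined.mono ?_ (hf.fiber _ q' rfl q hq))
      rintro x hx
      rw [Set.mem_preimage, hx]
      exact h2
  exact key (f q) (hA _ hp _ hq) hq q rfl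

theorem comp (hg : CellMap g) (hf : CellMap f) : CellMap (g ∘ f) where
  lift a b h := by
    obtain ⟨p, q, rfl, rfl, h'⟩ := hg.lift _ _ h
    obtain ⟨p', q', rfl, rfl, h''⟩ := hf.lift _ _ h'
    exact ⟨p', q', rfl, rfl, h''⟩
  fiber a := hf.connected_preimage (hg.fiber a)
  finite a := (hg.finite a).preimage' fun b _ => hf.finite b

end CellMap

theorem div_eq_iff_of_pos {x m a : ℤ} (hm : 0 < m) : x / m = a ↔ m * a ≤ x ∧ x < m * a + m := by
  rw [Int.ediv_eq_iff_of_pos hm]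
  constructor <;> rintro ⟨h1, h2⟩ <;> constructor <;> linarith [mul_comm a m]

/-- Fibers are horizontal segments of m cells, shifted by c from one row to the next. Since c < m,
segments stacked in consecutive rows still overlap. -/
theorem cellMap_shear_horizontal {c m : ℤ} (hc : 0 ≤ c) (hm : c < m) :
    CellMap fun p => ((p.1 + c * p.2) / m, p.2) := by
  have hm0 : 0 < m := by lia
  have hmem : ∀ x y X Y : ℤ, (((x + c * y) / m, y) : ℤ × ℤ) = (X, Y) ↔
      (m * X ≤ x + c * y ∧ x + c * y < m * X + m) ∧ y = Y := by
    intro x y X Y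
    rw [Prod.mk.injEq, div_eq_iff_of_pos hm0]
  refine ⟨?_, ?_, ?_⟩
  · have key : ∀ X Y X' Y' : ℤ, (X' = X + 1 ∧ Y' = Y) ∨ (X' = X ∧ Y' = Y + 1) →
        ∃ p q : ℤ × ℤ, (((p.1 + c * p.2) / m, p.2) : ℤ × ℤ) = (X, Y) ∧
          (((q.1 + c * q.2) / m, q.2) : ℤ × ℤ) = (X', Y') ∧ q - p ∈ vonNeumann.carrier := by
      rintro X Y X' Y' (⟨rfl, rfl⟩ | ⟨rfl, rfl⟩)
      · refine ⟨(m * X - c * Y' + m - 1, Y'), (m * X - c * Y' + m, Y'), ?_, ?_, ?_⟩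
        · rw [hmem]; refine ⟨⟨?_, ?_⟩, rfl⟩ <;> lia
        · rw [hmem]; refine ⟨⟨?_, ?_⟩, rfl⟩ <;> linarith
        · rw [mem_vonNeumann]; right; left; ext <;> simp
      · refine ⟨(m * X' - c * Y, Y), (m * X' - c * Y, Y + 1), ?_, ?_, ?_⟩
        · rw [hmem]; refine ⟨⟨?_, ?_⟩, rfl⟩ <;> lia
        · rw [hmem]; refine ⟨⟨?_, ?_⟩, rfl⟩ <;> linarith
        · rw [mem_vonNeumann]; left; ext <;> simp
    rintro ⟨X, Y⟩ ⟨X', Y'⟩ h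
    have h' : ((X' = X + 1 ∧ Y' = Y) ∨ (X' = X ∧ Y' = Y + 1)) ∨
        ((X = X' + 1 ∧ Y = Y') ∨ (X = X' ∧ Y = Y' + 1)) := by
      rw [mem_vonNeumann] at h
      simp only [Prod.mk_sub_mk, Prod.mk.injEq] at h
      lia
    rcases h' with h' | h'
    · exact key _ _ _ _ h'
    · obtain ⟨p, q, h1, h2, h3⟩ := key _ _ _ _ h'
      exact ⟨q, p, h2, h1, neg_sub_mem h3⟩
  · rintro ⟨X, Y⟩ ⟨x, y⟩ hp ⟨x', y'⟩ hq
    have h1 := (hmem _ _ _ _).1 hp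
    have h2 := (hmem _ _ _ _).1 hq
    obtain ⟨h1, rfl⟩ := h1
    obtain ⟨h2, rfl⟩ := h2
    rcases le_total x x' with hx | hx
    · exact joined_horizontal hx fun t h3 h4 => (hmem _ _ _ _).2 (by lia)
    · refine (joined_horizontal hx fun t h3 h4 => ?_).symm
      exact (hmem _ _ _ _).2 (by lia)
  · rintro ⟨X, Y⟩
    refine (((Set.finite_Ico (m * X - c * Y) (m * X - c * Y + m)).prod
      (Set.finite_singleton Y))).subset ?_
    rintro ⟨x, y⟩ hp
    obtain ⟨h1, rfl⟩ := (hmem _ _ _ _).1 hp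
    simp only [Set.mem_prod, Set.mem_Ico, Set.mem_singleton_iff, and_true]
    lia

theorem cellMap_shear_vertical {c n : ℤ} (hc : 0 ≤ c) (hn : c < n) :
    CellMap fun p => (p.1, (p.2 - c * p.1) / n) := by
  have hn0 : 0 < n := by lia
  have hmem : ∀ x y X Y : ℤ, ((x, (y - c * x) / n) : ℤ × ℤ) = (X, Y) ↔
      x = X ∧ (n * Y ≤ y - c * x ∧ y - c * x < n * Y + n) := by
    intro x y X Y
    rw [Prod.mk.injEq, div_eq_iff_of_pos hn0]
  refine ⟨?_, ?_, ?_⟩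
  · have key : ∀ X Y X' Y' : ℤ, (X' = X + 1 ∧ Y' = Y) ∨ (X' = X ∧ Y' = Y + 1) →
        ∃ p q : ℤ × ℤ, ((p.1, (p.2 - c * p.1) / n) : ℤ × ℤ) = (X, Y) ∧
          ((q.1, (q.2 - c * q.1) / n) : ℤ × ℤ) = (X', Y') ∧ q - p ∈ vonNeumann.carrier := by
      rintro X Y X' Y' (⟨rfl, rfl⟩ | ⟨rfl, rfl⟩)
      · refine ⟨(X, n * Y' + c * X + c), (X + 1, n * Y' + c * X + c), ?_, ?_, ?_⟩
        · rw [hmem]; refine ⟨rfl, ?_, ?_⟩ <;> linarith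
        · rw [hmem]; refine ⟨rfl, ?_, ?_⟩ <;> linarith
        · rw [mem_vonNeumann]; right; left; ext <;> simp
      · refine ⟨(X', n * Y + c * X' + n - 1), (X', n * Y + c * X' + n), ?_, ?_, ?_⟩
        · rw [hmem]; refine ⟨rfl, ?_, ?_⟩ <;> lia
        · rw [hmem]; refine ⟨rfl, ?_, ?_⟩ <;> linarith
        · rw [mem_vonNeumann]; left; ext <;> simp
    rintro ⟨X, Y⟩ ⟨X', Y'⟩ h
    have h' : ((X' = X + 1 ∧ Y' = Y) ∨ (X' = X ∧ Y' = Y + 1)) ∨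
        ((X = X' + 1 ∧ Y = Y') ∨ (X = X' ∧ Y = Y' + 1)) := by
      rw [mem_vonNeumann] at h
      simp only [Prod.mk_sub_mk, Prod.mk.injEq] at h
      lia
    rcases h' with h' | h'
    · exact key _ _ _ _ h'
    · obtain ⟨p, q, h1, h2, h3⟩ := key _ _ _ _ h'
      exact ⟨q, p, h2, h1, neg_sub_mem h3⟩
  · rintro ⟨X, Y⟩ ⟨x, y⟩ hp ⟨x', y'⟩ hq
    have h1 := (hmem _ _ _ _).1 hp
    have h2 := (hmem _ _ _ _).1 hq
    obtain ⟨rfl, h1⟩ := h1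
    obtain ⟨rfl, h2⟩ := h2
    rcases le_total y y' with hx | hx
    · exact joined_vertical hx fun t h3 h4 => (hmem _ _ _ _).2 (by lia)
    · refine (joined_vertical hx fun t h3 h4 => ?_).symm
      exact (hmem _ _ _ _).2 (by lia)
  · rintro ⟨X, Y⟩
    refine (((Set.finite_singleton X).prod
      (Set.finite_Ico (n * Y + c * X) (n * Y + c * X + n)))).subset ?_
    rintro ⟨x, y⟩ hp
    obtain ⟨rfl, h1⟩ := (hmem _ _ _ _).1 hp
    simp only [Set.mem_prod, Set.mem_Ico, Set.mem_singleton_iff, true_and]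
    lia

/-! ### Connectedness of level sets and of their complements -/

/-- A level set of a function that is monotone in every column, over an interval of columns,
is 4-connected if its sections in consecutive columns meet. -/
theorem connected_level {F : ℤ → ℤ → ℤ} (hF : ∀ x, Monotone (F x)) {j : ℤ}
    (hov : ∀ x, ∃ y, F x y = j ∧ F (x + 1) y = j) (α β : ℤ) :
    Connected4 {p | α ≤ p.1 ∧ p.1 < β ∧ F p.1 p.2 = j} := by
  set A : Set (ℤ × ℤ) := {p | α ≤ p.1 ∧ p.1 < β ∧ F p.1 p.2 = j} with hA
  have hcol : ∀ x y y', (x, y) ∈ A → (x, y') ∈ A → Joined A (x, y) (x, y') := by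
    have : ∀ x y y', (x, y) ∈ A → (x, y') ∈ A → y ≤ y' → Joined A (x, y) (x, y') := by
      rintro x y y' ⟨h1, h2, h3⟩ ⟨-, -, h4⟩ hy
      refine joined_vertical hy fun t h5 h6 => ⟨h1, h2, ?_⟩
      exact le_antisymm (h4 ▸ hF x h6) (h3 ▸ hF x h5)
    intro x y y' h h'
    rcases le_total y y' with hy | hy
    · exact this x y y' h h' hy
    · exact (this x y' y h' h hy).symm
  have key : ∀ x y, (x, y) ∈ A → ∀ x', x ≤ x' → ∀ y', (x', y') ∈ A →
      Joined A (x, y) (x', y') := by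
    intro x y h x' hx
    induction x', hx using Int.leInduction with
    | base => exact fun y' h' => hcol x y y' h h'
    | succ k hk ih =>
      rintro y' ⟨h1, h2, h3⟩
      obtain ⟨z, hz, hz'⟩ := hov k
      have hk1 : (k, z) ∈ A := ⟨h.1.trans hk, (lt_add_one k).trans h2, hz⟩
      have hk2 : (k + 1, z) ∈ A := ⟨h1, h2, hz'⟩
      exact ((ih z hk1).trans (joined_right hk1 hk2)).trans (hcol _ _ _ hk2 ⟨h1, h2, h3⟩)
  rintro ⟨x, y⟩ hp ⟨x', y'⟩ hq
  rcases le_total x x' with hx | hx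
  · exact key x y hp x' hx y' hq
  · exact (key x' y' hq x hx y hp).symm

/-- A level set of a function that is monotone in every column, over an interval of columns,
has no holes. -/
theorem connected_compl_level {F : ℤ → ℤ → ℤ} (hF : ∀ x, Monotone (F x)) {j H : ℤ}
    (hup : ∀ x y, H ≤ y → j < F x y) (hdown : ∀ x y, y ≤ -H → F x y < j) (α β : ℤ) :
    Connected4 {p | α ≤ p.1 ∧ p.1 < β ∧ F p.1 p.2 = j}ᶜ := by
  set A : Set (ℤ × ℤ) := {p | α ≤ p.1 ∧ p.1 < β ∧ F p.1 p.2 = j}ᶜ with hA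
  have hne : ∀ x y, F x y ≠ j → (x, y) ∈ A := fun x y h h' => h h'.2.2
  have hout : ∀ x y y', ¬(α ≤ x ∧ x < β) → Joined A (x, y) (x, y') := by
    have : ∀ x y y', ¬(α ≤ x ∧ x < β) → y ≤ y' → Joined A (x, y) (x, y') :=
      fun x y y' hx hy => joined_vertical hy fun t _ _ h => hx ⟨h.1, h.2.1⟩
    intro x y y' hx
    rcases le_total y y' with hy | hy
    · exact this x y y' hx hy
    · exact (this x y' y hx hy).symm
  have hrow : ∀ y, (∀ x, (x, y) ∈ A) → ∀ x, Joined A (x, y) (α - 1, y) := by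
    intro y h x
    rcases le_total x (α - 1) with hx | hx
    · exact joined_horizontal hx fun t _ _ => h t
    · exact (joined_horizontal hx fun t _ _ => h t).symm
  have htop := hrow H fun x => hne x H (hup x H le_rfl).ne'
  have hbot := hrow (-H) fun x => hne x (-H) (hdown x (-H) le_rfl).ne
  have hmid : ∀ y, Joined A (α - 1, y) (α - 1, H) := fun y => hout _ _ _ (by lia)
  have key : ∀ p ∈ A, Joined A p (α - 1, H) := by
    rintro ⟨x, y⟩ hp
    by_cases hx : α ≤ x ∧ x < β
    · rcases lt_or_gt_of_ne (fun h => hp ⟨hx.1, hx.2, h⟩ : F x y ≠ j) with h | h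
      · have h1 : Joined A (x, min y (-H)) (x, y) :=
          joined_vertical (min_le_left _ _) fun t _ h2 => hne x t ((hF x h2).trans_lt h).ne
        have h2 : Joined A (x, min y (-H)) (x, -H) :=
          joined_vertical (min_le_right _ _) fun t _ h2 => hne x t (hdown x t h2).ne
        exact ((h1.symm.trans h2).trans (hbot x)).trans (hmid _)
      · have h1 : Joined A (x, y) (x, max y H) :=
          joined_vertical (le_max_left _ _) fun t h2 _ => hne x t (h.trans_le (hF x h2)).ne'
        have h2 : Joined A (x, H) (x, max y H) :=
          joined_vertical (le_max_right _ _) fun t h2 _ => hne x t (hup x t h2).ne'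
        exact (h1.trans h2.symm).trans (htop x)
    · exact (hout x y H hx).trans (htop x)
  exact fun p hp q hq => (key p hp).trans (key q hq).symm

/-! ### The profile of dipping strips in one column -/

/-- The relative strip at relative height `ρ`: strips have height `h`, and the strips
`1, …, k` dip into the strip `0`, down to the heights `h - d, …, h - d + k - 1`. -/
def bulge (h d k ρ : ℤ) : ℤ :=
  if h - 1 - d < ρ ∧ ρ < h * k then min k (ρ - (h - 1) + d) else ρ / h

section bulge

variable {h d k k' i ρ ρ' m : ℤ}

theorem bulge_zero (hρ : 0 ≤ ρ) : bulge h d 0 ρ = ρ / h := by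
  rw [bulge, if_neg]
  rintro ⟨-, h2⟩
  lia

theorem bulge_mono (hk : 0 ≤ k) (hdh : d < h) (hd : 0 ≤ d) (hρ : ρ ≤ ρ') :
    bulge h d k ρ ≤ bulge h d k ρ' := by
  have hh : 0 < h := by lia
  unfold bulge
  split_ifs with h1 h2 h2
  · exact min_le_min_left _ (by lia)
  · have : k ≤ ρ' / h := by
      rw [Int.le_ediv_iff_mul_le hh]
      have : h * k ≤ ρ' := by lia
      linarith [mul_comm h k]
    exact (min_le_left _ _).trans this
  · have h3 : ρ < h * 1 := by lia
    have : ρ / h < 1 := by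
      rw [Int.ediv_lt_iff_lt_mul hh]; lia
    lia
  · exact Int.ediv_le_ediv hh hρ

theorem bulge_nonneg (hk : 0 ≤ k) (hh : 0 < h) (hρ : 0 ≤ ρ) : 0 ≤ bulge h d k ρ := by
  unfold bulge
  split_ifs with h1
  · lia
  · exact Int.ediv_nonneg hρ hh.le

theorem bulge_lt (hh : 0 < h) (hkm : k < m) (hρ : ρ < h * m) : bulge h d k ρ < m := by
  unfold bulge
  split_ifs with h1
  · lia
  · rw [Int.ediv_lt_iff_lt_mul hh]; linarith [mul_comm h m]

/-- Two columns whose depths differ by at most 1 have a common height in every strip, which keeps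
the strips connected while the dip deepens one step per column. -/
theorem exists_bulge_eq (hk : 0 ≤ k) (hkd : k ≤ d) (hk' : 0 ≤ k') (hkd' : k' ≤ d)
    (hkk : k' ≤ k + 1) (hkk' : k ≤ k' + 1) (hdh : d < h) (hi : 0 ≤ i) (him : i < m) :
    ∃ ρ, 0 ≤ ρ ∧ ρ < h * m ∧ bulge h d k ρ = i ∧ bulge h d k' ρ = i := by
  have hh : 0 < h := by lia
  have hm : h * 1 ≤ h * m := mul_le_mul_of_nonneg_left (by lia) hh.le
  rcases hi.eq_or_lt with rfl | hi
  · refine ⟨0, le_rfl, by lia, ?_, ?_⟩ <;>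
    · rw [bulge, if_neg (by lia), Int.zero_ediv]
  by_cases h1 : k ≤ i ∧ k' ≤ i
  · have h2 : h * k ≤ h * i := mul_le_mul_of_nonneg_left h1.1 hh.le
    have h3 : h * k' ≤ h * i := mul_le_mul_of_nonneg_left h1.2 hh.le
    -- Neither dip goes beyond strip i, so its undisturbed bottom row serves for both.
    refine ⟨h * i, by positivity, mul_lt_mul_of_pos_left him hh, ?_, ?_⟩ <;>
    · rw [bulge, if_neg (by lia), Int.mul_ediv_cancel_left _ hh.ne']
  · have h4 : i ≤ k ∧ i ≤ k' := by lia
    have h2 : h * 1 ≤ h * k := mul_le_mul_of_nonneg_left (by lia) hh.le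
    have h3 : h * 1 ≤ h * k' := mul_le_mul_of_nonneg_left (by lia) hh.le
    -- Depths differing by at most 1 leave only the case where i dips, or is the last to dip, in
    -- both columns; its squeezed row is at the same height in each.
    refine ⟨h - 1 - d + i, by lia, by lia, ?_, ?_⟩ <;>
    · rw [bulge, if_pos (by lia)]; lia

theorem bulge_spot (hk : 0 < d) (hh : 0 < h) : bulge h d d (h - 1) = d := by
  have h2 : h * 1 ≤ h * d := mul_le_mul_of_nonneg_left (by lia) hh.le
  rw [bulge, if_pos (by lia)]
  lia

end bulge

/-! ### Ribbons: geometry and dependence on the flags -/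

/-- Parameters of a dissection of the plane into slanted ribbons. -/
structure Ribbons where
  c : ℤ
  m : ℤ
  n : ℤ
  h : ℤ
  d : ℤ → ℤ
  q : ℤ → ℤ
  c_pos : 0 < c
  m_eq : m = c * c + 1
  c_lt_n : c < n
  d_nonneg : ∀ i, 0 ≤ d i
  d_lt : ∀ i, d i < m
  h_ge : ∀ i, 2 * d i + 2 ≤ h
  q_nonneg : ∀ i, 0 ≤ q i
  q_lt : ∀ i, q i < m

namespace Ribbons

variable (R : Ribbons) (f f' : ℤ × ℤ → ℤ → Prop)

theorem h_pos : 0 < R.h := by have := R.h_ge 0; have := R.d_nonneg 0; lia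
theorem n_pos : 0 < R.n := R.c_pos.trans R.c_lt_n
theorem c_lt_m : R.c < R.m := by rw [R.m_eq]; nlinarith [R.c_pos]
theorem m_pos : 0 < R.m := R.c_pos.trans R.c_lt_m
theorem d_lt_h (i : ℤ) : R.d i < R.h := by have := R.h_ge i; have := R.d_nonneg i; lia

/-- The column of slabs where the ribbon of `u` starts. -/
def C (u : ℤ × ℤ) : ℤ := u.1 + R.c * u.2
/-- The strip that contains the ribbon of `u`. -/
def J (u : ℤ × ℤ) : ℤ := u.2 - R.c * u.1

/-- The class of a column. -/
def cls (X : ℤ) : ℤ := X / R.h % R.n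
/-- The slab of a column. -/
def slab (X : ℤ) : ℤ := X / R.h / R.n
/-- The value of `C` for the positions with a spot in the slab of a column. -/
def ctr (X : ℤ) : ℤ := R.slab X - R.q (R.cls X)
/-- The index of a group of `m` strips, in a column. -/
def grp (X Y : ℤ) : ℤ := (Y / R.h + R.c * R.ctr X) / R.m
/-- The bottom strip of a group. -/
def base (X g : ℤ) : ℤ := R.m * g - R.c * R.ctr X
/-- The position whose ribbon lies in the bottom strip of a group. -/
def ref (X g : ℤ) : ℤ × ℤ := (R.ctr X - R.c * g, g)

open Classical in
/-- The number of strips that dip in a column. -/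
noncomputable def depth (X g : ℤ) : ℤ :=
  if f (R.ref X g) (R.cls X) then max 0 (min (X % R.h) (2 * R.d (R.cls X) - X % R.h)) else 0

/-- The strip that contains `(X, Y)`. -/
noncomputable def strip (X Y : ℤ) : ℤ :=
  R.base X (R.grp X Y) + bulge R.h (R.d (R.cls X)) (R.depth f X (R.grp X Y))
    (Y - R.h * R.base X (R.grp X Y))

theorem C_ref (X g : ℤ) : R.C (R.ref X g) = R.ctr X := by
  simp only [C, ref]; ring

theorem J_ref (X g : ℤ) : R.J (R.ref X g) = R.base X g := by
  simp only [J, ref, base, R.m_eq]; ring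

theorem depth_nonneg (X g : ℤ) : 0 ≤ R.depth f X g := by
  unfold depth; split_ifs
  · exact le_max_left _ _
  · exact le_rfl

theorem depth_le (X g : ℤ) : R.depth f X g ≤ R.d (R.cls X) := by
  unfold depth; split_ifs
  · exact max_le (R.d_nonneg _) (by lia)
  · exact R.d_nonneg _

/-- Blocks of h columns begin and end with straight strips, so that blocks with unrelated flags fit
together. This is what `h_ge` is for. -/
theorem depth_eq_zero (X g : ℤ) (h : X % R.h = 0 ∨ X % R.h = R.h - 1) : R.depth f X g = 0 := by
  unfold depth; split_ifs
  · have := R.h_ge (R.cls X)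
    have := R.d_nonneg (R.cls X)
    rw [max_eq_left]
    rcases h with h | h <;> rw [h] <;> lia
  · rfl

theorem grp_eq_iff (X Y g : ℤ) : R.grp X Y = g ↔
    0 ≤ Y - R.h * R.base X g ∧ Y - R.h * R.base X g < R.h * R.m := by
  have hh := R.h_pos
  rw [grp, div_eq_iff_of_pos R.m_pos]
  have h1 : R.m * g ≤ Y / R.h + R.c * R.ctr X ↔ R.base X g ≤ Y / R.h := by
    rw [base]; constructor <;> intro <;> lia
  have h2 : Y / R.h + R.c * R.ctr X < R.m * g + R.m ↔ Y / R.h < R.base X g + R.m := by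
    rw [base]; constructor <;> intro <;> lia
  rw [h1, h2, Int.le_ediv_iff_mul_le hh, Int.ediv_lt_iff_lt_mul hh]
  constructor <;> rintro ⟨h3, h4⟩ <;> constructor <;> nlinarith

theorem base_le_strip (X Y : ℤ) : R.base X (R.grp X Y) ≤ R.strip f X Y := by
  have h := (R.grp_eq_iff X Y _).1 rfl
  have := bulge_nonneg (d := R.d (R.cls X)) (R.depth_nonneg f X (R.grp X Y)) R.h_pos h.1
  rw [strip]; lia

theorem strip_lt (X Y : ℤ) : R.strip f X Y < R.base X (R.grp X Y) + R.m := by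
  have h := (R.grp_eq_iff X Y _).1 rfl
  have := bulge_lt (d := R.d (R.cls X)) R.h_pos
    ((R.depth_le f X (R.grp X Y)).trans_lt (R.d_lt _)) h.2
  rw [strip]; lia

theorem base_le_div (X Y : ℤ) : R.base X (R.grp X Y) ≤ Y / R.h := by
  have h := (R.grp_eq_iff X Y _).1 rfl
  rw [Int.le_ediv_iff_mul_le R.h_pos]
  linarith [mul_comm R.h (R.base X (R.grp X Y))]

theorem div_lt (X Y : ℤ) : Y / R.h < R.base X (R.grp X Y) + R.m := by
  have h := (R.grp_eq_iff X Y _).1 rfl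
  rw [Int.ediv_lt_iff_lt_mul R.h_pos]
  nlinarith

theorem strip_eq_div {X : ℤ} (Y : ℤ) (h : X % R.h = 0 ∨ X % R.h = R.h - 1) :
    R.strip f X Y = Y / R.h := by
  have hg := (R.grp_eq_iff X Y _).1 rfl
  rw [strip, R.depth_eq_zero f X _ h, bulge_zero hg.1, sub_eq_add_neg, ← mul_neg,
    Int.add_mul_ediv_left _ _ R.h_pos.ne']
  lia

/-- Inside a group this is the monotonicity of `bulge`. Dips never leave their group, so different
groups take values in disjoint successive intervals of m strips. -/
theorem strip_mono (X : ℤ) : Monotone (R.strip f X) := by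
  intro Y Y' hY
  have hg : R.grp X Y ≤ R.grp X Y' :=
    Int.ediv_le_ediv R.m_pos (by have := Int.ediv_le_ediv R.h_pos hY; lia)
  rcases hg.eq_or_lt with hg | hg
  · rw [strip, strip, ← hg]
    have := bulge_mono (ρ := Y - R.h * R.base X (R.grp X Y))
      (ρ' := Y' - R.h * R.base X (R.grp X Y)) (R.depth_nonneg f X (R.grp X Y))
      (R.d_lt_h (R.cls X)) (R.d_nonneg _) (by lia)
    lia
  · have h1 := R.strip_lt f X Y
    have h2 := R.base_le_strip f X Y'
    have h3 : R.base X (R.grp X Y) + R.m ≤ R.base X (R.grp X Y') := by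
      simp only [base]
      nlinarith [R.m_pos]
    lia

theorem strip_eq_of_grp {X Y g : ℤ} (h : R.grp X Y = g) : R.strip f X Y =
    R.base X g + bulge R.h (R.d (R.cls X)) (R.depth f X g) (Y - R.h * R.base X g) := by
  rw [strip, h]

/-- At a seam between blocks both columns are straight. Inside a block the reference position is the
same for both columns, and the depth changes by at most 1. -/
theorem exists_strip_eq (X j : ℤ) : ∃ Y, R.strip f X Y = j ∧ R.strip f (X + 1) Y = j := by
  have hh := R.h_pos
  have e1 := Int.emod_add_mul_ediv X R.h
  have e2 := Int.emod_nonneg X hh.ne'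
  have e3 := Int.emod_lt_of_pos X hh
  have e4 := Int.emod_add_mul_ediv (X + 1) R.h
  have e5 := Int.emod_nonneg (X + 1) hh.ne'
  have e6 := Int.emod_lt_of_pos (X + 1) hh
  by_cases hX : X % R.h = R.h - 1
  · have h1 : (X + 1) / R.h = X / R.h + 1 := by
      rw [div_eq_iff_of_pos hh]; constructor <;> linarith
    have h2 : (X + 1) % R.h = 0 := by rw [h1] at e4; linarith
    refine ⟨R.h * j, ?_, ?_⟩
    · rw [R.strip_eq_div f _ (.inr hX), Int.mul_ediv_cancel_left _ hh.ne']
    · rw [R.strip_eq_div f _ (.inl h2), Int.mul_ediv_cancel_left _ hh.ne']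
  · have h1 : (X + 1) / R.h = X / R.h := by
      rw [div_eq_iff_of_pos hh]; constructor <;> lia
    have h2 : (X + 1) % R.h = X % R.h + 1 := by rw [h1] at e4; linarith
    have hc : R.cls (X + 1) = R.cls X := by rw [cls, cls, h1]
    have ht : R.ctr (X + 1) = R.ctr X := by rw [ctr, ctr, hc, slab, slab, h1]
    set g := (j + R.c * R.ctr X) / R.m with hg
    have hb : R.base (X + 1) g = R.base X g := by rw [base, base, ht]
    have h3 := (div_eq_iff_of_pos R.m_pos).1 hg.symm
    have h4 : R.depth f (X + 1) g ≤ R.depth f X g + 1 ∧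
        R.depth f X g ≤ R.depth f (X + 1) g + 1 := by
      have : R.ref (X + 1) g = R.ref X g := by rw [ref, ref, ht]
      simp only [depth, this, hc, h2]
      split_ifs <;> lia
    obtain ⟨ρ, h5, h6, h7, h8⟩ := exists_bulge_eq (i := j - R.base X g) (m := R.m)
      (R.depth_nonneg f X g) (R.depth_le f X g) (R.depth_nonneg f (X + 1) g)
      (hc ▸ R.depth_le f (X + 1) g) h4.1 h4.2 (R.d_lt_h (R.cls X)) (by rw [base]; lia)
      (by rw [base]; lia)
    refine ⟨R.h * R.base X g + ρ, ?_, ?_⟩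
    · rw [R.strip_eq_of_grp f ((R.grp_eq_iff X _ g).2 (by lia)), add_sub_cancel_left, h7]
      lia
    · rw [R.strip_eq_of_grp f ((R.grp_eq_iff (X + 1) _ g).2 (by rw [hb]; lia)), hb, hc,
        add_sub_cancel_left, h8]
      lia

theorem strip_congr {X Y : ℤ}
    (h : f (R.ref X (R.grp X Y)) (R.cls X) ↔ f' (R.ref X (R.grp X Y)) (R.cls X)) :
    R.strip f X Y = R.strip f' X Y := by
  have : R.depth f X (R.grp X Y) = R.depth f' X (R.grp X Y) := by
    unfold depth
    split_ifs <;> tauto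
  rw [strip, strip, this]

theorem emod_add (X t : ℤ) : (X + R.n * R.h * t) % R.h = X % R.h := by
  rw [mul_right_comm, Int.add_mul_emod_self_right]

theorem div_add (X t : ℤ) : (X + R.n * R.h * t) / R.h = X / R.h + R.n * t := by
  rw [mul_right_comm, Int.add_mul_ediv_right _ _ R.h_pos.ne']

theorem cls_add (X t : ℤ) : R.cls (X + R.n * R.h * t) = R.cls X := by
  rw [cls, cls, div_add, Int.add_mul_emod_self_left]

theorem slab_add (X t : ℤ) : R.slab (X + R.n * R.h * t) = R.slab X + t := by
  rw [slab, slab, div_add, Int.add_mul_ediv_left _ _ R.n_pos.ne']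

/-- Translating by the image of v preserves classes, moves slabs by C v and group indices by `v.2`,
and so moves every reference position by v. -/
theorem strip_add (X Y : ℤ) (v : ℤ × ℤ) :
    R.strip f (X + R.n * R.h * R.C v) (Y + R.h * R.J v) =
      R.strip (fun u => f (u + v)) X Y + R.J v := by
  have ht : R.ctr (X + R.n * R.h * R.C v) = R.ctr X + R.C v := by
    rw [ctr, ctr, cls_add, slab_add]; ring
  have hb : ∀ g, R.base (X + R.n * R.h * R.C v) (g + v.2) = R.base X g + R.J v := by
    intro g
    simp only [base, ht]
    simp only [C, J, R.m_eq]; ring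
  have hg : R.grp (X + R.n * R.h * R.C v) (Y + R.h * R.J v) = R.grp X Y + v.2 := by
    rw [grp_eq_iff, hb, mul_add, add_sub_add_right_eq_sub, ← grp_eq_iff]
  have hr : R.ref (X + R.n * R.h * R.C v) (R.grp X Y + v.2) = R.ref X (R.grp X Y) + v := by
    ext
    · simp only [ref, ht, Prod.fst_add]
      simp only [C]; ring
    · simp [ref]
  have hd : R.depth f (X + R.n * R.h * R.C v) (R.grp X Y + v.2) =
      R.depth (fun u => f (u + v)) X (R.grp X Y) := by
    unfold depth
    rw [hr, cls_add, emod_add]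
  rw [strip, strip, hg, hb, hd, cls_add, mul_add, add_sub_add_right_eq_sub]
  ring

/-- The position whose ribbon contains the part of a strip in a slab. -/
def own (σ j : ℤ) : ℤ × ℤ := ((σ - R.c * j) / R.m, R.c * ((σ - R.c * j) / R.m) + j)

/-- From C v = m * `v.1` + c * J v, the ribbons of a strip start exactly every m slabs; the owner
comes from a Euclidean division. -/
theorem own_eq_iff (σ j : ℤ) (v : ℤ × ℤ) :
    R.own σ j = v ↔ R.J v = j ∧ R.C v ≤ σ ∧ σ < R.C v + R.m := by
  have hC : R.C v = R.m * v.1 + R.c * R.J v := by simp only [C, J, R.m_eq]; ring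
  constructor
  · rintro rfl
    have h1 := (div_eq_iff_of_pos (x := σ - R.c * j) R.m_pos).1 rfl
    have h2 : R.J (R.own σ j) = j := by simp [own, J]
    refine ⟨h2, ?_⟩
    rw [hC, h2, own]
    lia
  · rintro ⟨rfl, h⟩
    rw [hC] at h
    have h1 : (σ - R.c * R.J v) / R.m = v.1 := by
      rw [div_eq_iff_of_pos R.m_pos]; lia
    rw [own, h1, J]
    ext <;> simp

/-- The owner of `(X, Y)`. -/
noncomputable def target (p : ℤ × ℤ) : ℤ × ℤ := R.own (R.slab p.1) (R.strip f p.1 p.2)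

theorem target_eq_iff (p v : ℤ × ℤ) : R.target f p = v ↔
    R.strip f p.1 p.2 = R.J v ∧ R.C v ≤ R.slab p.1 ∧ R.slab p.1 < R.C v + R.m := by
  rw [target, own_eq_iff, eq_comm]

theorem C_add (u v : ℤ × ℤ) : R.C (u + v) = R.C u + R.C v := by simp [C]; ring
theorem J_add (u v : ℤ × ℤ) : R.J (u + v) = R.J u + R.J v := by simp [J]; ring

theorem target_add (p u v : ℤ × ℤ) :
    R.target f (p + (R.n * R.h * R.C v, R.h * R.J v)) = u + v ↔
      R.target (fun u => f (u + v)) p = u := by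
  rw [target_eq_iff, target_eq_iff, Prod.fst_add, Prod.snd_add, strip_add, slab_add, C_add, J_add]
  constructor <;> rintro ⟨h1, h2, h3⟩ <;> refine ⟨?_, ?_, ?_⟩ <;> lia

/-- The positions that may influence the ribbon of `(0, 0)`. -/
def Near (u : ℤ × ℤ) : Prop := |u.1| ≤ R.m ∧ |R.J u| ≤ R.m

theorem near_of_C {u : ℤ × ℤ} (h1 : |R.C u| ≤ R.m) (h2 : |R.J u| ≤ R.m) : R.Near u := by
  refine ⟨?_, h2⟩
  have hC : R.C u = R.m * u.1 + R.c * R.J u := by simp only [C, J, R.m_eq]; ring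
  rw [hC] at h1
  have hm := R.m_pos
  have hc := R.c_pos
  have hcm := R.c_lt_m
  rw [abs_le] at *
  constructor <;> by_contra! h3 <;> nlinarith

/-- A cell depends on the single flag of its group's reference position. For a cell of the ribbon of
0, that position has C and J at most m in absolute value. -/
theorem target_congr (h : ∀ u, R.Near u → ∀ i, f u i ↔ f' u i) {p : ℤ × ℤ}
    (hp : R.target f p = 0) : R.target f' p = 0 := by
  rw [target_eq_iff] at hp ⊢
  rw [← R.strip_congr f f' (X := p.1) (Y := p.2) (h _ ?_ _)]
  · exact hp
  obtain ⟨h1, h2, h3⟩ := hp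
  have h4 := R.base_le_strip f p.1 p.2
  have h5 := R.strip_lt f p.1 p.2
  have hJ : R.J 0 = 0 := by simp [J]
  have hC : R.C 0 = 0 := by simp [C]
  rw [hC] at h2 h3
  rw [h1, hJ] at h4 h5
  have h6 := R.q_lt (R.cls p.1)
  have h7 := R.q_nonneg (R.cls p.1)
  refine R.near_of_C ?_ ?_
  · rw [C_ref, ctr, abs_le]; lia
  · rw [J_ref, abs_le]; lia

/-- The cells of the ribbon of `(0, 0)`, as a level set over an interval of columns. -/
theorem target_zero_iff (p : ℤ × ℤ) : R.target f p = 0 ↔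
    0 ≤ p.1 ∧ p.1 < R.h * (R.n * R.m) ∧ R.strip f p.1 p.2 = 0 := by
  have hJ : R.J 0 = 0 := by simp [J]
  have hC : R.C 0 = 0 := by simp [C]
  rw [target_eq_iff, hJ, hC, slab, Int.le_ediv_iff_mul_le R.n_pos, zero_mul,
    Int.le_ediv_iff_mul_le R.h_pos, zero_mul, zero_add, Int.ediv_lt_iff_lt_mul R.n_pos,
    Int.ediv_lt_iff_lt_mul R.h_pos]
  have : R.m * R.n * R.h = R.h * (R.n * R.m) := by ring
  rw [this]
  tauto

theorem lt_strip {X Y : ℤ} (hY : R.h * R.m ≤ Y) : 0 < R.strip f X Y := by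
  have h1 := R.base_le_strip f X Y
  have h2 := R.div_lt X Y
  have h3 : R.m ≤ Y / R.h := by
    rw [Int.le_ediv_iff_mul_le R.h_pos]; linarith [mul_comm R.h R.m]
  lia

theorem strip_lt_zero {X Y : ℤ} (hY : Y ≤ -(R.h * R.m)) : R.strip f X Y < 0 := by
  have h1 := R.strip_lt f X Y
  have h2 := R.base_le_div X Y
  have h3 : Y / R.h < -R.m + 1 := by
    rw [Int.ediv_lt_iff_lt_mul R.h_pos]; nlinarith [R.h_pos]
  lia

theorem target_zero_eq : {p | R.target f p = 0} =
    {p | 0 ≤ p.1 ∧ p.1 < R.h * (R.n * R.m) ∧ R.strip f p.1 p.2 = 0} :=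
  Set.ext (R.target_zero_iff f)

theorem connected_target : Connected4 {p | R.target f p = 0} := by
  rw [target_zero_eq]
  exact connected_level (R.strip_mono f) (fun x => R.exists_strip_eq f x 0) _ _

theorem connected_compl_target : Connected4 {p | R.target f p = 0}ᶜ := by
  rw [target_zero_eq]
  exact connected_compl_level (R.strip_mono f) (H := R.h * R.m) (fun _ _ h => R.lt_strip f h)
    (fun _ _ h => R.strip_lt_zero f h) _ _

theorem finite_target : {p | ∃ f, R.target f p = 0}.Finite := by
  refine ((Set.finite_Ico 0 (R.h * (R.n * R.m))).prod
    (Set.finite_Ioo (-(R.h * R.m)) (R.h * R.m))).subset ?_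
  rintro p ⟨f, hp⟩
  rw [target_zero_iff] at hp
  refine ⟨⟨hp.1, hp.2.1⟩, ?_, ?_⟩
  · by_contra! h
    exact (R.strip_lt_zero f h).ne hp.2.2
  · by_contra! h
    exact (R.lt_strip f h).ne' hp.2.2

theorem target_origin : R.target f (0, 0) = 0 := by
  rw [target_zero_iff, R.strip_eq_div f _ (by simp), Int.zero_ediv]
  have := R.h_pos; have := R.n_pos; have := R.m_pos
  exact ⟨le_rfl, by positivity, rfl⟩

theorem slab_lattice (t : ℤ) : R.slab (R.n * R.h * t) = t := by
  have := R.slab_add 0 t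
  simpa [slab] using this

theorem lattice_emod (t : ℤ) : (R.n * R.h * t) % R.h = 0 := by
  have := R.emod_add 0 t
  simpa using this

/-- With `target_left`, this provides the doors: edges in straight columns, where no flag can alter
the owners. They lead from 0 to (0, 1) and to (1, c). -/
theorem target_below : R.target f (R.n * R.h * R.c, R.h - 1) = 0 ∧
    R.target f (R.n * R.h * R.c, R.h) = (0, 1) := by
  have hh := R.h_pos
  have := R.c_pos
  have := R.c_lt_m
  rw [target_eq_iff, target_eq_iff]
  simp only [slab_lattice, R.strip_eq_div f _ (.inl (R.lattice_emod _)), Int.ediv_self hh.ne']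
  rw [Int.ediv_eq_zero_of_lt (by lia) (by lia)]
  simp [J, C]
  lia

theorem target_left : R.target f (R.n * R.h * R.m - 1, 0) = 0 ∧
    R.target f (R.n * R.h * R.m, 0) = (1, R.c) := by
  have hh := R.h_pos
  have hn := R.n_pos
  have hm := R.m_pos
  have h1 : (R.n * R.h * R.m - 1) / R.h = R.n * R.m - 1 := by
    rw [div_eq_iff_of_pos hh]; constructor <;> nlinarith
  have h2 : (R.n * R.h * R.m - 1) % R.h = R.h - 1 := by
    have := Int.emod_add_mul_ediv (R.n * R.h * R.m - 1) R.h
    rw [h1] at this; linarith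
  have h3 : R.slab (R.n * R.h * R.m - 1) = R.m - 1 := by
    rw [slab, h1, div_eq_iff_of_pos hn]; constructor <;> nlinarith
  rw [target_eq_iff, target_eq_iff]
  simp only [slab_lattice, R.strip_eq_div f _ (.inl (R.lattice_emod _)), h3,
    R.strip_eq_div f _ (.inr h2), Int.zero_ediv]
  simp [J, C, R.m_eq]
  have := mul_self_nonneg R.c
  refine ⟨?_, ?_, ?_⟩ <;> linarith

/-- The spot of class `i` belongs to `0` or to `w`, according to the flag. -/
theorem target_spot {i : ℤ} {w : ℤ × ℤ} (hi : 0 ≤ i) (hin : i < R.n) (hd : R.d i = R.J w)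
    (hw : 0 < R.J w) (hq : R.C w ≤ R.q i ∧ R.q i < R.C w + R.m) :
    ∃ p, ∀ f, (¬f 0 i → R.target f p = 0) ∧ (f 0 i → R.target f p = w) := by
  have hh := R.h_pos
  have hn := R.n_pos
  have hdh := R.h_ge i
  -- The column of block i, in slab `q i`, where the triangular dip attains its full depth `d i`.
  -- Its reference position is 0.
  set X := R.h * (R.n * R.q i + i) + R.d i with hX
  have h1 : X / R.h = R.n * R.q i + i := by
    rw [div_eq_iff_of_pos hh]; constructor <;> lia
  have h2 : X % R.h = R.d i := by
    have := Int.emod_add_mul_ediv X R.h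
    rw [h1] at this; linarith
  have h3 : R.slab X = R.q i := by
    rw [slab, h1, div_eq_iff_of_pos hn]; constructor <;> lia
  have h4 : R.cls X = i := by
    rw [cls, h1, Int.mul_add_emod_self_left, Int.emod_eq_of_lt hi hin]
  have h5 : R.ctr X = 0 := by rw [ctr, h3, h4, sub_self]
  have hC : R.C 0 = 0 := by simp [C]
  have hJ : R.J 0 = 0 := by simp [J]
  have h6 : R.base X 0 = 0 := by simp [base, h5]
  have h7 : R.ref X 0 = 0 := by simp [ref, h5]
  have h8 : R.grp X (R.h - 1) = 0 := by
    rw [grp_eq_iff, h6]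
    have := R.m_pos
    constructor <;> nlinarith
  refine ⟨(X, R.h - 1), fun f => ⟨fun hf => ?_, fun hf => ?_⟩⟩
  · rw [target_eq_iff, R.strip_eq_of_grp f h8, h3, h6, hC, hJ, depth, h7, h4, if_neg hf,
      bulge_zero (by lia), Int.ediv_eq_zero_of_lt (by lia) (by lia)]
    have := R.q_nonneg i
    have := R.q_lt i
    lia
  · rw [target_eq_iff, R.strip_eq_of_grp f h8, h3, h6, depth, h7, h4, if_pos hf, h2, two_mul,
      add_sub_cancel_right, min_self, max_eq_right (R.d_nonneg i), mul_zero, sub_zero,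
      bulge_spot (by lia) hh, zero_add]
    exact ⟨hd, hq⟩

/-! ### From the ribbon grid to cells on a square lattice -/

/-- The map from cells to the grid where ribbons are horizontal. -/
def cell (p : ℤ × ℤ) : ℤ × ℤ :=
  ((p.1 + R.c * p.2) / R.m, (p.2 - R.c * ((p.1 + R.c * p.2) / R.m)) / R.n)

theorem cellMap : CellMap R.cell :=
  (cellMap_shear_vertical R.c_pos.le R.c_lt_n).comp
    (cellMap_shear_horizontal R.c_pos.le R.c_lt_m)

/-- The scale of the dissection. -/
def scale : ℕ := (R.h * R.n * R.m).toNat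

theorem scale_eq : (R.scale : ℤ) = R.h * R.n * R.m := by
  have := R.h_pos; have := R.n_pos; have := R.m_pos
  exact Int.toNat_of_nonneg (by positivity)

theorem scale_pos : 0 < R.scale := by
  have := R.h_pos; have := R.n_pos; have := R.m_pos
  have h : 0 < R.h * R.n * R.m := by positivity
  rw [← scale_eq] at h
  exact_mod_cast h

/-- The scale h * n * m makes both Euclidean divisions exact on the lattice, which thus goes to the
translations of the ribbon grid. -/
theorem cell_add (p v : ℤ × ℤ) : R.cell (p + (R.scale : ℤ) • v) =
    R.cell p + (R.n * R.h * R.C v, R.h * R.J v) := by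
  have h1 : (p.1 + R.scale * v.1 + R.c * (p.2 + R.scale * v.2)) / R.m =
      (p.1 + R.c * p.2) / R.m + R.n * R.h * R.C v := by
    rw [← Int.add_mul_ediv_left _ _ R.m_pos.ne', scale_eq, C]
    congr 1; ring
  ext
  · simpa [cell] using h1
  · simp only [cell, Prod.snd_add, Prod.smul_snd, Prod.fst_add, Prod.smul_fst, smul_eq_mul, h1]
    rw [← Int.add_mul_ediv_left _ _ R.n_pos.ne', scale_eq, C, J]
    congr 1; rw [R.m_eq]; ring

end Ribbons

/-! ### Layouts: the properties of the dissection that the simulation uses -/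

/-- A dissection of the plane into regions, one for each position, that depends on a field of
labels on the pairs of neighbors. The regions of two neighbors intersect as soon as they
correspond to fields that give different labels to this pair. -/
structure Layout (N : Neighborhood) (Λ : Type) where
  scale : ℕ
  scale_pos : 0 < scale
  owner : (ℤ × ℤ → {w // w ∈ N.carrier} → Λ) → ℤ × ℤ → ℤ × ℤ
  owner_add : ∀ E p u v, owner E (p + (scale : ℤ) • v) = u + v ↔
    owner (fun u => E (u + v)) p = u
  known : Finset (ℤ × ℤ)
  owner_congr : ∀ E E', (∀ v ∈ known, E v = E' v) → ∀ p, owner E p = 0 → owner E' p = 0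
  zero_mem : 0 ∈ known
  neighbor_mem : ∀ w ∈ N.carrier, w ∈ known
  owner_zero : ∀ E, owner E 0 = 0
  exists_ne : ∀ E, ∃ p ≠ 0, owner E p = 0
  connected : ∀ E, Connected4 {p | owner E p = 0}
  connected_compl : ∀ E, Connected4 {p | owner E p = 0}ᶜ
  finite : {p | ∃ E, owner E p = 0}.Finite
  shift : Fin 2 → ℤ × ℤ
  shift_ne : ∀ k, shift k ≠ 0
  door : Fin 2 → ℤ × ℤ
  dir : Fin 2 → {w // w ∈ vonNeumann.carrier}
  owner_door : ∀ E k, owner E (door k) = 0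
  owner_door_add : ∀ E k, owner E (door k + (dir k).1) = shift k
  known_induction : ∀ Q : ℤ × ℤ → Prop, Q 0 →
    (∀ v ∈ known, ∀ k, v - shift k ∈ known → (Q v ↔ Q (v - shift k))) → ∀ v ∈ known, Q v
  spot : ∀ w : {w // w ∈ N.carrier},
    (∀ E E', E 0 w ≠ E' 0 w → ∃ p, owner E p = 0 ∧ owner E' p = w.1) ∨
    (∀ E E', E 0 (N.opp w) ≠ E' 0 (N.opp w) → ∃ p, owner E p = 0 ∧ owner E' p = -w.1)

namespace Ribbons

variable (R : Ribbons)

/-- The positions that may influence the ribbon of `(0, 0)`, as a finite set. -/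
noncomputable def nearFinset : Finset (ℤ × ℤ) :=
  (Finset.Icc (-R.m) R.m ×ˢ Finset.Icc (-R.m) R.m).image fun p => (p.1, p.2 + R.c * p.1)

theorem mem_nearFinset {u : ℤ × ℤ} : u ∈ R.nearFinset ↔ R.Near u := by
  simp only [nearFinset, Finset.mem_image, Finset.mem_product, Finset.mem_Icc, Near, abs_le, J]
  constructor
  · rintro ⟨p, h, rfl⟩
    simpa using h
  · intro h
    exact ⟨(u.1, u.2 - R.c * u.1), h, by ext <;> simp⟩

/-- In the coordinates (`u.1`, J u) the known positions form a square, and the shifts (1, c) and (0,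
1) are unit steps: walk along the axis J = 0, then across it. -/
theorem near_induction {Q : ℤ × ℤ → Prop} (h0 : Q 0)
    (h1 : ∀ v, R.Near v → R.Near (v - (0, 1)) → (Q v ↔ Q (v - (0, 1))))
    (h2 : ∀ v, R.Near v → R.Near (v - (1, R.c)) → (Q v ↔ Q (v - (1, R.c)))) {v : ℤ × ℤ}
    (hv : R.Near v) : Q v := by
  have near : ∀ a b, -R.m ≤ a ∧ a ≤ R.m → -R.m ≤ b ∧ b ≤ R.m → R.Near (a, R.c * a + b) := by
    intro a b ha hb
    simpa [Near, J, abs_le] using ⟨ha, hb⟩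
  have hm := R.m_pos
  have step1 : ∀ a b, -R.m ≤ a ∧ a ≤ R.m → -R.m + 1 ≤ b ∧ b ≤ R.m →
      (Q (a, R.c * a + b) ↔ Q (a, R.c * a + (b - 1))) := by
    intro a b ha hb
    have e : ((a, R.c * a + b) : ℤ × ℤ) - (0, 1) = (a, R.c * a + (b - 1)) := by
      ext <;> simp; ring
    rw [← e]
    exact h1 _ (near a b ha (by lia)) (e ▸ near a (b - 1) ha (by lia))
  have step2 : ∀ a, -R.m + 1 ≤ a ∧ a ≤ R.m →
      (Q (a, R.c * a + 0) ↔ Q (a - 1, R.c * (a - 1) + 0)) := by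
    intro a ha
    have e : ((a, R.c * a + 0) : ℤ × ℤ) - (1, R.c) = (a - 1, R.c * (a - 1) + 0) := by
      ext <;> simp; ring
    rw [← e]
    exact h2 _ (near a 0 (by lia) (by lia)) (e ▸ near (a - 1) 0 (by lia) (by lia))
  have walk : ∀ P : ℤ → Prop, P 0 → (∀ a, -R.m + 1 ≤ a ∧ a ≤ R.m → (P a ↔ P (a - 1))) →
      ∀ a, -R.m ≤ a ∧ a ≤ R.m → P a := by
    intro P hP hs a ha
    induction a using Int.induction_on with
    | zero => exact hP
    | succ i ih => rw [hs _ (by lia)]; simpa using ih (by lia)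
    | pred i ih => exact (hs _ (by lia)).1 (ih (by lia))
  have hcol := walk (fun a => Q (a, R.c * a + 0))
    (by simp only [mul_zero, add_zero]; exact h0) step2
  obtain ⟨a, b⟩ := v
  obtain ⟨ha, hb⟩ := hv
  simp only [abs_le, J] at ha hb
  have := walk (fun b => Q (a, R.c * a + b)) (hcol a ha) (fun b hb => step1 a b ha hb) _ hb
  simpa using this

/-- A dissection into ribbons yields a layout, provided that every label of every pair of
neighbors (up to a symmetry) has a class of columns. -/
theorem nonempty_layout {N : Neighborhood} {Λ : Type} (g : ℤ → Option ({w // w ∈ N.carrier} × Λ))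
    (hJ : ∀ w ∈ N.carrier, R.J w ≠ 0) (hnear : ∀ w ∈ N.carrier, R.Near w)
    (hg : ∀ w : {w // w ∈ N.carrier}, 0 < R.J w.1 → ∀ y, ∃ i, 0 ≤ i ∧ i < R.n ∧
      g i = some (w, y) ∧ R.d i = R.J w.1 ∧ R.C w.1 ≤ R.q i ∧ R.q i < R.C w.1 + R.m) :
    Nonempty (Layout N Λ) := by
  let flag : (ℤ × ℤ → {w // w ∈ N.carrier} → Λ) → ℤ × ℤ → ℤ → Prop :=
    fun E u i => ∃ w y, g i = some (w, y) ∧ E u w ≠ y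
  have spot : ∀ w : {w // w ∈ N.carrier}, 0 < R.J w.1 → ∀ E E', E 0 w ≠ E' 0 w →
      ∃ p, R.target (flag E) (R.cell p) = 0 ∧ R.target (flag E') (R.cell p) = w.1 := by
    intro w hw E E' hE
    obtain ⟨i, hi, hin, hgi, hd, hq⟩ := hg w hw (E 0 w)
    obtain ⟨P, hP⟩ := R.target_spot hi hin hd hw hq
    -- The lift of an arbitrary edge at P is only used to get a preimage of P.
    obtain ⟨p, -, rfl, -, -⟩ := R.cellMap.lift P (P + (0, 1)) (by simp [vonNeumann])
    refine ⟨p, (hP _).1 ?_, (hP _).2 ⟨w, _, hgi, hE.symm⟩⟩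
    rintro ⟨w', y, h1, h2⟩
    rw [hgi] at h1
    obtain ⟨rfl, rfl⟩ := Prod.mk.inj (Option.some.inj h1)
    exact h2 rfl
  obtain ⟨p, p', hp, hp', hpp⟩ := R.cellMap.lift (R.n * R.h * R.c, R.h - 1)
    (R.n * R.h * R.c, R.h) (by simp [vonNeumann])
  obtain ⟨q, q', hq, hq', hqq⟩ := R.cellMap.lift (R.n * R.h * R.m - 1, 0)
    (R.n * R.h * R.m, 0) (by simp [vonNeumann])
  have h0 : R.cell 0 = (0, 0) := by simp [cell]
  have hq0 : q ≠ 0 := by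
    rintro rfl
    rw [h0, Prod.mk.injEq] at hq
    have := R.h_ge 0
    have := R.d_nonneg 0
    nlinarith [hq.1, mul_pos R.n_pos R.m_pos]
  refine ⟨{
    scale := R.scale
    scale_pos := R.scale_pos
    owner := fun E p => R.target (flag E) (R.cell p)
    owner_add := fun E p u v => by rw [cell_add]; exact R.target_add _ _ _ _
    known := R.nearFinset
    owner_congr := fun E E' h p hp => R.target_congr (flag E) _
      (fun u hu i => by simp only [flag, h u (R.mem_nearFinset.2 hu)]) hp
    zero_mem := R.mem_nearFinset.2 (by simp [Near, J, R.m_pos.le])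
    neighbor_mem := fun w hw => R.mem_nearFinset.2 (hnear w hw)
    owner_zero := fun E => by rw [h0]; exact R.target_origin _
    exists_ne := fun E => ⟨q, hq0, by simp only [hq, (R.target_left _).1]⟩
    connected := fun E => R.cellMap.connected_preimage (R.connected_target (flag E))
    connected_compl := fun E => R.cellMap.connected_preimage (R.connected_compl_target (flag E))
    finite := (R.finite_target.preimage' fun b _ => R.cellMap.finite b).subset
      fun p ⟨E, h⟩ => ⟨flag E, h⟩
    shift := ![(0, 1), (1, R.c)]
    shift_ne := by simp [Fin.forall_fin_two, Prod.ext_iff]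
    door := ![p, q]
    dir := ![⟨p' - p, hpp⟩, ⟨q' - q, hqq⟩]
    owner_door := fun E => by
      simp [Fin.forall_fin_two, hp, hq, (R.target_below _).1, (R.target_left _).1]
    owner_door_add := fun E => by
      simp [Fin.forall_fin_two, hp', hq', (R.target_below _).2, (R.target_left _).2]
    known_induction := fun Q h0 h v hv => R.near_induction h0
      (fun v hv hv' => h v (R.mem_nearFinset.2 hv) 0 (R.mem_nearFinset.2 hv'))
      (fun v hv hv' => h v (R.mem_nearFinset.2 hv) 1 (R.mem_nearFinset.2 hv'))
      (R.mem_nearFinset.1 hv)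
    spot := fun w => ?_ }⟩
  rcases lt_or_gt_of_ne (hJ w.1 w.2) with h | h
  · right
    refine spot (N.opp w) ?_
    have : R.J (N.opp w).1 = - R.J w.1 := by simp [Neighborhood.opp, J]; ring
    lia
  · exact .inl (spot w h)

end Ribbons

theorem exists_layout (N : Neighborhood) (Λ : Type) [Finite Λ] : Nonempty (Layout N Λ) := by
  classical
  obtain ⟨K, hK⟩ : ∃ K : ℕ, ∀ w ∈ N.carrier, |w.1| ≤ K ∧ |w.2| ≤ K := by
    refine ⟨∑ w ∈ N.carrier, (w.1.natAbs + w.2.natAbs), fun w hw => ?_⟩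
    have := Finset.single_le_sum (f := fun w : ℤ × ℤ => w.1.natAbs + w.2.natAbs)
      (fun _ _ => Nat.zero_le _) hw
    constructor <;> · rw [Int.abs_eq_natAbs]; exact_mod_cast (by lia)
  obtain ⟨n₀, ⟨e⟩⟩ := Finite.exists_equiv_fin ({w // w ∈ N.carrier} × Λ)
  -- Exceeding all coordinates of neighbors, c makes J nonzero on N; moreover |C w| and |J w| are at
  -- most K * (c + 1) = c² - 1 < m.
  set c : ℤ := K + 1 with hc
  set m : ℤ := c * c + 1 with hm
  let g : ℤ → Option ({w // w ∈ N.carrier} × Λ) :=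
    fun i => if h : i.toNat < n₀ then some (e.symm ⟨i.toNat, h⟩) else none
  have hC : ∀ w ∈ N.carrier, |w.1 + c * w.2| < m := by
    intro w hw
    obtain ⟨h1, h2⟩ := hK w hw
    have := abs_add_le w.1 (c * w.2)
    rw [abs_mul, abs_of_pos (show 0 < c by lia)] at this
    nlinarith
  have hJ : ∀ w ∈ N.carrier, |w.2 - c * w.1| < m := by
    intro w hw
    obtain ⟨h1, h2⟩ := hK w hw
    have := abs_sub w.2 (c * w.1)
    rw [abs_mul, abs_of_pos (show 0 < c by lia)] at this
    nlinarith
  have hm0 : 0 < m := by nlinarith [mul_self_nonneg c]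
  let R : Ribbons := {
    c := c
    m := m
    -- Room for one class per pair of a neighbor and a label, and c < n for the shear.
    n := c + 1 + n₀
    h := 2 * m + 2
    d := fun i => (g i).elim 0 fun x => max 0 (x.1.1.2 - c * x.1.1.1)
    -- The first slab common to the ribbons of 0 and of the neighbor, which fill [0, m) and [C w, C
    -- w + m).
    q := fun i => (g i).elim 0 fun x => max 0 (x.1.1.1 + c * x.1.1.2)
    c_pos := by lia
    m_eq := rfl
    c_lt_n := by lia
    d_nonneg := fun i => by cases g i <;> simp
    d_lt := fun i => by
      cases hi : g i with
      | none => simpa using hm0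
      | some x => exact max_lt hm0 ((le_abs_self _).trans_lt (hJ _ x.1.2))
    h_ge := fun i => by
      cases hi : g i with
      | none => simp; lia
      | some x =>
        have := max_lt hm0 ((le_abs_self _).trans_lt (hJ _ x.1.2))
        simp only [Option.elim]; lia
    q_nonneg := fun i => by cases g i <;> simp
    q_lt := fun i => by
      cases hi : g i with
      | none => simpa using hm0
      | some x => exact max_lt hm0 ((le_abs_self _).trans_lt (hC _ x.1.2)) }
  refine R.nonempty_layout g ?_ ?_ ?_
  · intro w hw h0
    obtain ⟨h1, h2⟩ := hK w hw
    have h0 : w.2 = c * w.1 := sub_eq_zero.1 h0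
    rcases eq_or_ne w.1 0 with h | h
    · rw [h, mul_zero] at h0
      exact N.zero_notMem ((Prod.ext h h0 : w = (0, 0)) ▸ hw)
    · have := Int.one_le_abs h
      rw [h0, abs_mul, abs_of_pos (show 0 < c by lia)] at h2
      nlinarith
  · intro w hw
    refine ⟨?_, (hJ w hw).le⟩
    have := (hK w hw).1
    change |w.1| ≤ m
    nlinarith
  · intro w hw y
    have hi : g (e (w, y)).val = some (w, y) := by simp [g]
    have h1 := abs_lt.1 (hC w.1 w.2)
    refine ⟨(e (w, y)).val, by lia, ?_, hi, ?_, ?_⟩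
    · have := (e (w, y)).isLt
      change _ < c + 1 + (n₀ : ℤ)
      lia
    · change (g _).elim 0 _ = _
      rw [hi]
      exact max_eq_right hw.le
    · change w.1.1 + c * w.1.2 ≤ (g _).elim 0 _ ∧ (g _).elim 0 _ < w.1.1 + c * w.1.2 + m
      rw [hi]
      simp only [Option.elim]
      lia

/-! ### The map χ -/

namespace Substitution

variable {N N' : Neighborhood} {X X' : Type*} {T : Finset (Tile N X)} {T' : Finset (Tile N' X')}

/-- Discarding incomplete copies leaves the complete ones untouched, so the two filters amount to
the second one. -/
theorem χ_eq_some_iff (F : Substitution T T') (τ : Tiling T') (p : ℤ × ℤ) (a : {t // t ∈ T'}) :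
    (F.χ τ).toFun p = some a ↔ τ.toFun p = some a ∧ ∃ t, ∃ π ∈ F.φ t, ∃ u : ℤ × ℤ,
      τ.ContainsAt π ((F.scale : ℤ) • u) ∧ p - (F.scale : ℤ) • u ∈ π.dom := by
  have restrict_iff : ∀ (σ : Tiling T') A p a,
      (σ.restrict A).toFun p = some a ↔ p ∈ A ∧ σ.toFun p = some a := by
    intro σ A p a
    simp only [Tiling.restrict]
    split_ifs with h <;> simp [h]
  have contains_iff : ∀ t, ∀ π ∈ F.φ t, ∀ q,
      (F.complete τ).ContainsAt π q ↔ τ.ContainsAt π q := by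
    intro t π hπ q
    constructor
    · exact fun h v b hb => ((restrict_iff _ _ _ _).1 (h v b hb)).2
    · intro h v b hb
      refine (restrict_iff _ _ _ _).2 ⟨⟨t, π, hπ, q, h, b, ?_⟩, h v b hb⟩
      rwa [add_sub_cancel_left]
  rw [χ, aligned, restrict_iff, complete, restrict_iff]
  constructor
  · rintro ⟨⟨t, π, hπ, u, h, hp⟩, -, ha⟩
    exact ⟨ha, t, π, hπ, u, (contains_iff t π hπ _).1 h, hp⟩
  · rintro ⟨ha, t, π, hπ, u, h, hp⟩
    exact ⟨⟨t, π, hπ, u, (contains_iff t π hπ _).2 h, hp⟩, ⟨t, π, hπ, _, h, hp⟩, ha⟩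

theorem χ_flatten (F : Substitution T T') {τ : Tiling T} {P : PolyTiling T' F.scale}
    (h : F.Replaces τ P) : F.χ P.flatten = P.flatten := by
  ext p : 2
  refine Option.ext fun a => ?_
  rw [χ_eq_some_iff]
  refine and_iff_left_of_imp fun ha => ?_
  obtain ⟨u, π, hu, hπ⟩ := (P.flatten_eq_some_iff _ _).1 ha
  cases ht : τ.toFun u with
  | none => rw [h.1 u ht] at hu; cases hu
  | some t =>
    obtain ⟨π', hπ', hu'⟩ := h.2 u t ht
    obtain rfl : π = π' := Option.some.inj (hu.symm.trans hu')
    refine ⟨t, π, hπ', u, fun v b hb => ?_, a, hπ⟩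
    refine (P.flatten_eq_some_iff _ _).2 ⟨u, π, hu, ?_⟩
    rwa [add_sub_cancel_left]

end Substitution

theorem exists_option_fun {α β : Type*} {r : α → β → Prop}
    (h : ∀ a b b', r a b → r a b' → b = b') :
    ∃ f : α → Option β, ∀ a b, f a = some b ↔ r a b := by
  have : ∀ a, ∃ o : Option β, ∀ b, o = some b ↔ r a b := by
    intro a
    by_cases ha : ∃ b, r a b
    · obtain ⟨b, hb⟩ := ha
      refine ⟨some b, fun b' => ?_⟩
      rw [Option.some_inj]
      exact ⟨fun e => e ▸ hb, h a b b' hb⟩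
    · exact ⟨none, fun b =>
        ⟨fun h => (Option.some_ne_none b h.symm).elim, fun h => absurd ⟨b, h⟩ ha⟩⟩
  choose f hf using this
  exact ⟨f, hf⟩

theorem opp_opp {N : Neighborhood} (w : {w // w ∈ N.carrier}) : N.opp (N.opp w) = w :=
  Subtype.ext (neg_neg w.1)

theorem opp_ne {N : Neighborhood} (w : {w // w ∈ N.carrier}) : N.opp w ≠ w := by
  intro h
  have h1 : -w.1 = w.1 := congrArg Subtype.val h
  have h2 : w.1 = (0, 0) := by
    have h3 := congrArg Prod.fst h1
    have h4 := congrArg Prod.snd h1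
    simp only [Prod.fst_neg, Prod.snd_neg] at h3 h4
    ext <;> simp only <;> lia
  exact N.zero_notMem (h2 ▸ w.2)

/-! ### Microtiles and the polyominoes of a field -/

namespace Layout

variable {N : Neighborhood} {Λ : Type} (L : Layout N Λ)

/-- The labels known in the region of a position. -/
abbrev Know : Type := {v // v ∈ L.known} → {w // w ∈ N.carrier} → Λ

/-- What is known of a field around `u`. -/
def loc (E : ℤ × ℤ → {w // w ∈ N.carrier} → Λ) (u : ℤ × ℤ) : L.Know := fun v => E (u + v.1)

open Classical in
/-- A field with given known labels. -/
noncomputable def ext [Inhabited Λ] (e : L.Know) : ℤ × ℤ → {w // w ∈ N.carrier} → Λ :=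
  fun v => if h : v ∈ L.known then e ⟨v, h⟩ else fun _ => default

/-- The doubled midpoints of the edges between the cells of the regions. -/
noncomputable def keys : Finset (ℤ × ℤ) :=
  (L.finite.toFinset ×ˢ vonNeumann.carrier).image fun a => a.1 + (a.1 + a.2)

/-- The glues of the microtiles: glues between cells of the same region, which identify the
known labels and the edge, and glues between regions, which carry the labels known by both
regions at the doors, and nothing elsewhere. -/
abbrev Glue : Type :=
  (L.Know × Option {k // k ∈ L.keys}) ⊕
    (Fin 2 → Option ({v // v ∈ L.known} → Option ({w // w ∈ N.carrier} → Λ)))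

/-- All the tiles. -/
noncomputable def tiles [Finite Λ] : Finset (Tile vonNeumann L.Glue) :=
  Set.finite_univ.toFinset

theorem mem_tiles [Finite Λ] (a : Tile vonNeumann L.Glue) : a ∈ L.tiles := by simp [tiles]

open Classical in
/-- The name of an edge. -/
noncomputable def key (k : ℤ × ℤ) : Option {k // k ∈ L.keys} :=
  if h : k ∈ L.keys then some ⟨k, h⟩ else none

theorem key_inj {k k' : ℤ × ℤ} (hk : k ∈ L.keys) (h : L.key k = L.key k') : k = k' := by
  unfold key at h
  rw [dif_pos hk] at h
  split_ifs at h with h'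
  exact congrArg Subtype.val (Option.some.inj h)

/-- The edge of the cell `x` in the direction `w` is the outlet `k`. -/
def Outlet (k : Fin 2) (x : ℤ × ℤ) (w : {w // w ∈ vonNeumann.carrier}) : Prop :=
  x = L.door k ∧ w = L.dir k

/-- The edge of the cell `x` in the direction `w` is the inlet `k`. -/
def Inlet (k : Fin 2) (x : ℤ × ℤ) (w : {w // w ∈ vonNeumann.carrier}) : Prop :=
  x + (L.scale : ℤ) • L.shift k = L.door k + (L.dir k).1 ∧ w = vonNeumann.opp (L.dir k)

open Classical in
/-- The labels that two regions have to agree on at a door. -/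
noncomputable def info (e : L.Know) (x : ℤ × ℤ) (w : {w // w ∈ vonNeumann.carrier}) :
    Fin 2 → Option ({v // v ∈ L.known} → Option ({w // w ∈ N.carrier} → Λ)) := fun k =>
  if L.Outlet k x w then some fun v => if v.1 - L.shift k ∈ L.known then some (e v) else none
  else if L.Inlet k x w then
    some fun v => if h : v.1 - L.shift k ∈ L.known then some (e ⟨v.1 - L.shift k, h⟩) else none
  else none

variable {L}

theorem Outlet.not_inlet {k : Fin 2} {x x' : ℤ × ℤ} {w : {w // w ∈ vonNeumann.carrier}}
    (h : L.Outlet k x w) : ¬L.Inlet k x' w := by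
  rintro ⟨-, h'⟩
  exact opp_ne _ (h'.symm.trans h.2)

theorem info_of_outlet {e : L.Know} {k : Fin 2} {x : ℤ × ℤ} {w : {w // w ∈ vonNeumann.carrier}}
    (h : L.Outlet k x w) {v : ℤ × ℤ} (hv : v ∈ L.known) (hv' : v - L.shift k ∈ L.known) :
    (L.info e x w k).map (fun g => g ⟨v, hv⟩) = some (some (e ⟨v, hv⟩)) := by
  simp only [info, if_pos h, Option.map_some, if_pos hv']

theorem info_of_inlet {e : L.Know} {k : Fin 2} {x : ℤ × ℤ}
    {w : {w // w ∈ vonNeumann.carrier}} (h : L.Inlet k x w) {v : ℤ × ℤ} (hv : v ∈ L.known)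
    (hv' : v - L.shift k ∈ L.known) :
    (L.info e x w k).map (fun g => g ⟨v, hv⟩) = some (some (e ⟨v - L.shift k, hv'⟩)) := by
  simp only [info, if_neg fun h' : L.Outlet k x w => h'.not_inlet h, if_pos h, Option.map_some,
    dif_pos hv']

theorem info_of_outlet_of_inlet {e e' : L.Know} {k : Fin 2} {x x' : ℤ × ℤ}
    {w w' : {w // w ∈ vonNeumann.carrier}} (h : L.Outlet k x w) (h' : L.Inlet k x' w')
    (he : ∀ v (hv : v ∈ L.known) (hv' : v - L.shift k ∈ L.known),
      e ⟨v, hv⟩ = e' ⟨v - L.shift k, hv'⟩) : L.info e x w k = L.info e' x' w' k := by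
  simp only [info, if_pos h, if_neg fun h'' : L.Outlet k x' w' => h''.not_inlet h', if_pos h']
  congr 1
  funext v
  split_ifs with hv
  · rw [he v.1 v.2 hv]
  · rfl

section Inhabited

variable [Inhabited Λ]

theorem ext_of_mem (e : L.Know) {v : ℤ × ℤ} (h : v ∈ L.known) : L.ext e v = e ⟨v, h⟩ := by
  rw [ext, dif_pos h]

variable (L) in
/-- The region that corresponds to the known labels. -/
def shape (e : L.Know) : Set (ℤ × ℤ) := {p | L.owner (L.ext e) p = 0}

/-- Locality and equivariance together: the region of u in a global field is the shape cut out by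
the labels known around u. -/
theorem owner_eq_iff (E : ℤ × ℤ → {w // w ∈ N.carrier} → Λ) (p u : ℤ × ℤ) :
    L.owner E (p + (L.scale : ℤ) • u) = u ↔ p ∈ L.shape (L.loc E u) := by
  have h := L.owner_add E p 0 u
  rw [zero_add] at h
  rw [h, shape, Set.mem_ofPred_eq]
  constructor <;> refine L.owner_congr _ _ (fun v hv => ?_) p
  · rw [ext_of_mem _ hv, loc, add_comm]
  · rw [ext_of_mem _ hv, loc, add_comm]

theorem mem_shape_iff (e : L.Know) (p u : ℤ × ℤ) :
    p ∈ L.shape e ↔ L.owner (fun v => L.ext e (v - u)) (p + (L.scale : ℤ) • u) = u := by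
  have h := L.owner_add (fun v => L.ext e (v - u)) p 0 u
  simp only [zero_add, add_sub_cancel_right] at h
  exact h.symm

theorem finite_shape (e : L.Know) : (L.shape e).Finite := L.finite.subset fun _ h => ⟨_, h⟩

theorem zero_mem_shape (e : L.Know) : 0 ∈ L.shape e := L.owner_zero _

theorem exists_add_mem_shape {e : L.Know} {x : ℤ × ℤ} (hx : x ∈ L.shape e) :
    ∃ w : {w // w ∈ vonNeumann.carrier}, x + w.1 ∈ L.shape e := by
  obtain ⟨y, hy, hxy⟩ : ∃ y ∈ L.shape e, y ≠ x := by
    by_cases h : x = 0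
    · obtain ⟨p, hp, hp'⟩ := L.exists_ne (L.ext e)
      exact ⟨p, hp', h ▸ hp⟩
    · exact ⟨0, zero_mem_shape e, Ne.symm h⟩
  rcases (L.connected (L.ext e) x hx y hy).cases_head with h | ⟨z, ⟨-, h1, h2⟩, -⟩
  · exact absurd h.symm hxy
  · exact ⟨⟨_, h2⟩, by rw [add_sub_cancel]; exact h1⟩

open Classical in
variable (L) in
/-- The microtile at the position `x` of a region. -/
noncomputable def micro (e : L.Know) (x : ℤ × ℤ) : Tile vonNeumann L.Glue := fun w =>
  if x + w.1 ∈ L.shape e then .inl (e, L.key (x + (x + w.1))) else .inr (L.info e x w)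

/-- A region has at least two cells and is connected, so each cell has an internal edge. Its glue
names e and the doubled midpoint of the edge; with the direction of the edge, this gives the cell.
-/
theorem micro_inj {e e' : L.Know} {x x' : ℤ × ℤ} (hx : x ∈ L.shape e)
    (h : L.micro e x = L.micro e' x') : e = e' ∧ x = x' := by
  obtain ⟨w, hw⟩ := exists_add_mem_shape hx
  have h1 := congrFun h w
  simp only [micro, if_pos hw] at h1
  split_ifs at h1
  obtain ⟨h2, h3⟩ := Prod.mk.inj (Sum.inl.inj h1)
  refine ⟨h2, ?_⟩
  have h4 := L.key_inj (Finset.mem_image.2 ⟨(x, w.1), by simpa using ⟨_, hx⟩, rfl⟩) h3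
  have h5 := congrArg Prod.fst h4
  have h6 := congrArg Prod.snd h4
  simp only [Prod.fst_add, Prod.snd_add] at h5 h6
  ext <;> lia

/-- Doors do not move with the field, so an edge between regions of a common field is an outlet on
one side exactly when it is the matching inlet on the other. -/
theorem outlet_inlet {E : ℤ × ℤ → {w // w ∈ N.carrier} → Λ} {u u' v v' : ℤ × ℤ}
    {w : {w // w ∈ vonNeumann.carrier}} {k : Fin 2} (hv : v ∈ L.shape (L.loc E u))
    (hv' : v' ∈ L.shape (L.loc E u'))
    (h : v' + (L.scale : ℤ) • u' = v + (L.scale : ℤ) • u + w.1) :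
    (L.Outlet k v w ↔ L.Inlet k v' (vonNeumann.opp w)) ∧
      (L.Outlet k v w → u' = u + L.shift k) := by
  rw [← owner_eq_iff] at hv hv'
  have key : L.Outlet k v w → u' = u + L.shift k := by
    rintro ⟨rfl, rfl⟩
    have := (L.owner_add E (L.door k + (L.dir k).1) (L.shift k) u).2 (L.owner_door_add _ k)
    rw [h, add_right_comm] at hv'
    rw [← hv', this, add_comm]
  refine ⟨⟨fun hk => ?_, ?_⟩, key⟩
  · have := key hk
    obtain ⟨rfl, rfl⟩ := hk
    refine ⟨?_, rfl⟩
    rw [this, smul_add] at h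
    linear_combination h
  · rintro ⟨h1, h2⟩
    have hw : w = L.dir k := by rw [← opp_opp w, h2, opp_opp]
    have h3 : v + (L.scale : ℤ) • u = L.door k + (L.scale : ℤ) • (u' - L.shift k) := by
      rw [← hw] at h1
      rw [smul_sub]
      linear_combination h1 - h
    have h4 := (L.owner_add E (L.door k) 0 (u' - L.shift k)).2 (L.owner_door _ k)
    rw [zero_add, ← h3, hv] at h4
    refine ⟨?_, hw⟩
    rw [h4] at h3
    exact add_right_cancel h3

variable [Finite Λ]

open Classical in
variable (L) in
/-- The polyomino that covers a region. -/
noncomputable def poly (e : L.Know) : Tiling L.tiles where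
  toFun p := if p ∈ L.shape e then some ⟨L.micro e p, L.mem_tiles _⟩ else none
  sticks := by
    intro p w t t' h h'
    split_ifs at h h' with h1 h2
    rw [← Option.some.inj h, ← Option.some.inj h', Sticks]
    have h3 : p + w.1 + (vonNeumann.opp w).1 = p := add_neg_cancel_right _ _
    simp only [micro, h3, if_pos h1, if_pos h2]
    rw [add_comm]

theorem poly_eq_some_iff {e : L.Know} {p : ℤ × ℤ} {a : {a // a ∈ L.tiles}} :
    (L.poly e).toFun p = some a ↔ p ∈ L.shape e ∧ a.1 = L.micro e p := by
  simp only [poly]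
  split_ifs with h
  · rw [Option.some_inj, Subtype.ext_iff]
    exact ⟨fun h' => ⟨h, h'.symm⟩, fun h' => h'.2.symm⟩
  · simp [h]

theorem dom_poly (e : L.Know) : (L.poly e).dom = L.shape e := by
  ext p
  constructor
  · rintro ⟨a, ha⟩
    exact (poly_eq_some_iff.1 ha).1
  · exact fun h => ⟨⟨L.micro e p, L.mem_tiles _⟩, poly_eq_some_iff.2 ⟨h, rfl⟩⟩

theorem isFilledPolyomino_poly (e : L.Know) : (L.poly e).IsFilledPolyomino := by
  refine ⟨⟨?_, ?_⟩, ?_⟩ <;> rw [dom_poly]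
  · exact finite_shape e
  · exact L.connected _
  · exact L.connected_compl _

open Classical in
variable (L) in
/-- The polyominoes that correspond to a field. -/
noncomputable def place (E : ℤ × ℤ → {w // w ∈ N.carrier} → Λ) (D : Set (ℤ × ℤ)) :
    PolyTiling L.tiles L.scale where
  toFun u := if u ∈ D then some (L.poly (L.loc E u)) else none
  finite := by
    intro u π h
    split_ifs at h
    rw [← Option.some.inj h, dom_poly]
    exact finite_shape _
  disjoint := by
    intro u u' π π' h h' hu
    split_ifs at h h'
    rw [← Option.some.inj h, ← Option.some.inj h', dom_poly, dom_poly, Set.disjoint_left]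
    rintro _ ⟨v, hv, rfl⟩ ⟨v', hv', h⟩
    rw [← owner_eq_iff] at hv hv'
    simp only at h
    rw [h, hv] at hv'
    exact hu hv'
  sticks := by
    intro u u' π π' h h' v v' t t' ht ht' w hw
    split_ifs at h h'
    rw [← Option.some.inj h, poly_eq_some_iff] at ht
    rw [← Option.some.inj h', poly_eq_some_iff] at ht'
    obtain ⟨hv, ht⟩ := ht
    obtain ⟨hv', ht'⟩ := ht'
    rw [Sticks, ht, ht']
    have e1 : v' + (L.scale : ℤ) • u' = v + (L.scale : ℤ) • u + w.1 := by rw [hw]; abel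
    have e2 : v + (L.scale : ℤ) • u = v' + (L.scale : ℤ) • u' + (vonNeumann.opp w).1 := by
      rw [e1]; exact (add_neg_cancel_right _ _).symm
    by_cases huu : u = u'
    · subst huu
      have e3 : v + w.1 = v' := add_right_cancel (b := (L.scale : ℤ) • u) (by rw [e1]; abel)
      have e4 : v' + (vonNeumann.opp w).1 = v := by
        rw [← e3]; exact add_neg_cancel_right _ _
      simp only [micro, e3, e4, if_pos hv, if_pos hv', add_comm v']
    · have h3 : v + w.1 ∉ L.shape (L.loc E u) := by
        intro h3
        rw [← owner_eq_iff, add_right_comm, ← e1] at h3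
        rw [← owner_eq_iff] at hv'
        exact huu (h3.symm.trans hv')
      have h4 : v' + (vonNeumann.opp w).1 ∉ L.shape (L.loc E u') := by
        intro h4
        rw [← owner_eq_iff, add_right_comm, ← e2] at h4
        rw [← owner_eq_iff] at hv
        exact huu (hv.symm.trans h4)
      simp only [micro, if_neg h3, if_neg h4]
      congr 1
      funext k
      obtain ⟨h5, h6⟩ := outlet_inlet (k := k) hv hv' e1
      obtain ⟨h7, h8⟩ := outlet_inlet (k := k) hv' hv e2
      rw [opp_opp] at h7
      by_cases hk : L.Outlet k v w
      · refine info_of_outlet_of_inlet hk (h5.1 hk) fun a _ _ => ?_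
        simp only [loc, h6 hk]
        congr 1; abel
      by_cases hk' : L.Inlet k v w
      · refine (info_of_outlet_of_inlet (h7.2 hk') hk' fun a _ _ => ?_).symm
        simp only [loc, h8 (h7.2 hk')]
        congr 1; abel
      · simp only [info, if_neg hk, if_neg hk', if_neg (h5.not.1 hk), if_neg (h7.not.2 hk')]

theorem place_eq_some_iff {E : ℤ × ℤ → {w // w ∈ N.carrier} → Λ} {D : Set (ℤ × ℤ)} {u : ℤ × ℤ}
    {π : Tiling L.tiles} :
    (L.place E D).toFun u = some π ↔ u ∈ D ∧ L.poly (L.loc E u) = π := by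
  simp only [place]
  split_ifs with h <;> simp [h]

end Inhabited

end Layout

/-! ### The substitution and the simulation -/

namespace Layout

variable {N : Neighborhood} {X : Type*} {T : Finset (Tile N X)} {Λ : Type} {L : Layout N Λ}
  {enc : X → Λ}

variable (L enc) in
/-- The known labels are compatible with the tile `t`. -/
def Valid (t : {t // t ∈ T}) (e : L.Know) : Prop :=
  (∀ w, e ⟨0, L.zero_mem⟩ w = enc (t.1 w)) ∧
    ∀ w, e ⟨w.1, L.neighbor_mem w.1 w.2⟩ (N.opp w) = e ⟨0, L.zero_mem⟩ w

theorem Valid.unique (henc : Function.Injective enc) {t t' : {t // t ∈ T}} {e : L.Know}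
    (h : L.Valid enc t e) (h' : L.Valid enc t' e) : t = t' :=
  Subtype.ext (funext fun w => henc ((h.1 w).symm.trans (h'.1 w)))

open Classical in
/-- A symmetric field that extends the glues of a tiling. -/
theorem exists_field [Inhabited Λ] (enc : X → Λ) (τ : Tiling T) :
    ∃ E : ℤ × ℤ → {w // w ∈ N.carrier} → Λ,
      ∀ (L : Layout N Λ) u t, τ.toFun u = some t → L.Valid enc t (L.loc E u) := by
  let E : ℤ × ℤ → {w // w ∈ N.carrier} → Λ := fun u w =>
    -- A position without a tile borrows the glue of its tiled neighbor, so that the field is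
    -- symmetric even at the border of the domain.
    match τ.toFun u, τ.toFun (u + w.1) with
    | some t, _ => enc (t.1 w)
    | none, some t => enc (t.1 (N.opp w))
    | none, none => default
  have h1 : ∀ u t w, τ.toFun u = some t → E u w = enc (t.1 w) := by
    intro u t w h
    simp only [E, h]
  have h2 : ∀ u w, E (u + w.1) (N.opp w) = E u w := by
    intro u w
    have e : u + w.1 + (N.opp w).1 = u := add_neg_cancel_right _ _
    simp only [E, e]
    rcases h : τ.toFun u with _ | t <;> rcases h' : τ.toFun (u + w.1) with _ | t'
    · rfl
    · rfl
    · simp only [opp_opp]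
    · exact congrArg enc (τ.sticks u w t t' h h').symm
  refine ⟨E, fun L u t h => ⟨fun w => ?_, fun w => ?_⟩⟩
  · simp only [loc, add_zero]
    exact h1 u t w h
  · simp only [loc, add_zero]
    exact h2 u w

variable [Inhabited Λ]

/-- The regions of two neighbors that do not stick to each other intersect. -/
theorem exists_common_cell {t t' : {t // t ∈ T}} {e e' : L.Know} (h : L.Valid enc t e)
    (h' : L.Valid enc t' e') (w : {w // w ∈ N.carrier})
    (hs : ∀ E E' : ℤ × ℤ → {w // w ∈ N.carrier} → Λ, E 0 w ≠ E' 0 w →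
      ∃ p, L.owner E p = 0 ∧ L.owner E' p = w.1)
    (hne : enc (t.1 w) ≠ enc (t'.1 (N.opp w))) :
    ∃ p ∈ L.shape e, p - (L.scale : ℤ) • w.1 ∈ L.shape e' := by
  obtain ⟨p, hp, hp'⟩ := hs (L.ext e) (fun v => L.ext e' (v - w.1)) (by
    have h1 : (0 : ℤ × ℤ) - w.1 = (N.opp w).1 := zero_sub _
    -- The spot is governed by the label filed under position 0, which the region of w sees at -w;
    -- the second half of `Valid` equates it with the glue of t'.
    have h2 := h'.2 (N.opp w)
    rw [opp_opp] at h2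
    rw [h1, ext_of_mem e L.zero_mem, ext_of_mem e' (L.neighbor_mem _ (N.opp w).2), h.1, h2,
      h'.1]
    exact hne)
  refine ⟨p, hp, ?_⟩
  rw [mem_shape_iff _ _ w.1, sub_add_cancel]
  exact hp'

variable [Finite Λ]

/-- The labels known in two regions with a common door agree. -/
theorem know_eq_of_door {P : PolyTiling L.tiles L.scale} {u : ℤ × ℤ} {k : Fin 2} {e e' : L.Know}
    (h : P.toFun u = some (L.poly e)) (h' : P.toFun (u + L.shift k) = some (L.poly e'))
    {v : ℤ × ℤ} (hv : v ∈ L.known) (hv' : v - L.shift k ∈ L.known) :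
    e ⟨v, hv⟩ = e' ⟨v - L.shift k, hv'⟩ := by
  set x := L.door k with hx
  set w := L.dir k with hw
  set x' := x + w.1 - (L.scale : ℤ) • L.shift k with hx'
  have h1 : x ∈ L.shape e := L.owner_door _ k
  have h2 : x + w.1 ∉ L.shape e := fun h2 =>
    L.shift_ne k ((L.owner_door_add _ k).symm.trans h2)
  have h3 : x' ∈ L.shape e' := by
    rw [mem_shape_iff _ _ (L.shift k), hx', sub_add_cancel]
    exact L.owner_door_add _ k
  have e1 : x' + (vonNeumann.opp w).1 + (L.scale : ℤ) • L.shift k = x := by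
    simp only [hx', Neighborhood.opp]; abel
  have h4 : x' + (vonNeumann.opp w).1 ∉ L.shape e' := by
    rw [mem_shape_iff _ _ (L.shift k), e1, L.owner_door]
    exact (L.shift_ne k).symm
  have hs := P.sticks u (u + L.shift k) _ _ h h' x x' ⟨L.micro e x, L.mem_tiles _⟩
    ⟨L.micro e' x', L.mem_tiles _⟩ (poly_eq_some_iff.2 ⟨h1, rfl⟩) (poly_eq_some_iff.2 ⟨h3, rfl⟩)
    w (by rw [hx', smul_add]; abel)
  simp only [Sticks, micro, if_neg h2, if_neg h4] at hs
  have hk := congrFun (Sum.inr.inj hs) k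
  have h5 := info_of_outlet (e := e) (⟨rfl, rfl⟩ : L.Outlet k x w) hv hv'
  have h6 := info_of_inlet (e := e') (⟨sub_add_cancel _ _, rfl⟩ : L.Inlet k x' _) hv hv'
  rw [hk, h6] at h5
  exact (Option.some.inj (Option.some.inj h5)).symm

variable (L) in
/-- The substitution that replaces a tile by the polyominoes with compatible labels. -/
noncomputable def substitution (henc : Function.Injective enc) (T : Finset (Tile N X)) :
    Substitution T L.tiles where
  scale := L.scale
  scale_pos := L.scale_pos
  φ t := {π | ∃ e, L.Valid enc t e ∧ π = L.poly e}
  finite := by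
    rintro t _ ⟨e, -, rfl⟩
    rw [dom_poly]
    exact finite_shape e
  reference := by
    rintro t _ ⟨e, -, rfl⟩
    rw [dom_poly]
    exact zero_mem_shape e
  specific := by
    rintro t t' ht _ ⟨e, he, rfl⟩ _ ⟨e', he', rfl⟩ u u' a a' ha ha' rfl
    obtain ⟨h1, h2⟩ := poly_eq_some_iff.1 ha
    obtain ⟨h3, h4⟩ := poly_eq_some_iff.1 ha'
    obtain ⟨rfl, -⟩ := micro_inj h1 (h2.symm.trans h4)
    exact ht (he.unique henc he')

section Substitution

variable {henc : Function.Injective enc} {τ τ₁ τ₂ : Tiling T} {P P₁ P₂ : PolyTiling L.tiles L.scale}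

theorem exists_of_replaces (h : (L.substitution henc T).Replaces τ P) {u : ℤ × ℤ}
    {π : Tiling L.tiles} (hu : P.toFun u = some π) :
    ∃ t e, τ.toFun u = some t ∧ L.Valid enc t e ∧ π = L.poly e := by
  cases ht : τ.toFun u with
  | none => rw [h.1 u ht] at hu; cases hu
  | some t =>
    obtain ⟨π', ⟨e, he, rfl⟩, hu'⟩ := h.2 u t ht
    exact ⟨t, e, rfl, he, Option.some.inj (hu.symm.trans hu')⟩

theorem replaces_place {E : ℤ × ℤ → {w // w ∈ N.carrier} → Λ}
    (hE : ∀ u t, τ.toFun u = some t → L.Valid enc t (L.loc E u)) :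
    (L.substitution henc T).Replaces τ (L.place E τ.dom) := by
  refine ⟨fun u hu => ?_, fun u t hu => ?_⟩
  · refine Option.eq_none_iff_forall_ne_some.2 fun π hπ => ?_
    obtain ⟨⟨t, ht⟩, -⟩ := place_eq_some_iff.1 hπ
    rw [hu] at ht
    cases ht
  · exact ⟨_, ⟨_, hE u t hu, rfl⟩, place_eq_some_iff.2 ⟨⟨t, hu⟩, rfl⟩⟩

/-- The microtile at the reference cell of u names its labels and its offset 0. The other
poly-tiling must therefore have the same polyomino at u, and the labels determine the tile. -/
theorem eq_some_of_flatten_eq (h₁ : (L.substitution henc T).Replaces τ₁ P₁)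
    (h₂ : (L.substitution henc T).Replaces τ₂ P₂) (h : P₁.flatten = P₂.flatten) {u : ℤ × ℤ}
    {t : {t // t ∈ T}} (ht : τ₁.toFun u = some t) : τ₂.toFun u = some t := by
  obtain ⟨π, ⟨e, he, rfl⟩, hu⟩ := h₁.2 u t ht
  have h3 := (P₁.flatten_eq_some_iff ((L.scale : ℤ) • u) ⟨L.micro e 0, L.mem_tiles _⟩).2
    ⟨u, _, hu, poly_eq_some_iff.2 ⟨by rw [sub_self]; exact zero_mem_shape e, by rw [sub_self]⟩⟩
  rw [h, PolyTiling.flatten_eq_some_iff] at h3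
  obtain ⟨u', π', hu', h4⟩ := h3
  obtain ⟨t', e', ht', he', rfl⟩ := exists_of_replaces h₂ hu'
  obtain ⟨h5, h6⟩ := poly_eq_some_iff.1 h4
  obtain ⟨rfl, h7⟩ := micro_inj (zero_mem_shape e) h6
  have h8 : u = u' := by
    have h9 : (L.scale : ℤ) ≠ 0 := by exact_mod_cast L.scale_pos.ne'
    exact smul_right_injective _ h9 (sub_eq_zero.1 h7.symm)
  rw [h8, ht', he.unique henc he']

theorem eq_of_flatten_eq (h₁ : (L.substitution henc T).Replaces τ₁ P₁)
    (h₂ : (L.substitution henc T).Replaces τ₂ P₂) (h : P₁.flatten = P₂.flatten) : τ₁ = τ₂ := by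
  ext u : 2
  exact Option.ext fun t => ⟨eq_some_of_flatten_eq h₁ h₂ h, eq_some_of_flatten_eq h₂ h₁ h.symm⟩

/-- Every polyomino agrees with E at its own position by validity. As all positions are occupied,
every door is active, and `known_induction` spreads the agreement to all the known labels. -/
theorem toFun_eq_of_isTotal (hτ : τ.IsTotal) (h : (L.substitution henc T).Replaces τ P)
    {E : ℤ × ℤ → {w // w ∈ N.carrier} → Λ}
    (hE : ∀ u t, τ.toFun u = some t → L.Valid enc t (L.loc E u)) (u : ℤ × ℤ) :
    P.toFun u = some (L.poly (L.loc E u)) := by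
  have h1 : ∀ u, ∃ t e, τ.toFun u = some t ∧ L.Valid enc t e ∧ P.toFun u = some (L.poly e) := by
    intro u
    obtain ⟨t, ht⟩ : u ∈ τ.dom := by rw [hτ]; trivial
    obtain ⟨π, ⟨e, he, rfl⟩, hu⟩ := h.2 u t ht
    exact ⟨t, e, ht, he, hu⟩
  choose t e ht he hP using h1
  have key : ∀ v ∈ L.known, ∀ (hv : v ∈ L.known) u, e u ⟨v, hv⟩ = E (u + v) := by
    refine L.known_induction _ (fun hv u => funext fun w => ?_) fun v hv k hv' => ?_
    · rw [(he u).1 w, ← (hE u _ (ht u)).1 w]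
      rfl
    · have hd := fun u => know_eq_of_door (hP u) (hP (u + L.shift k)) hv hv'
      constructor
      · intro hQ _ u
        have := hd (u - L.shift k)
        rw [sub_add_cancel] at this
        rw [← this, hQ hv]
        congr 1; abel
      · intro hQ _ u
        rw [hd u, hQ hv']
        congr 1; abel
  rw [hP u, (funext fun v => key v.1 v.2 v.2 u : e u = L.loc E u)]

theorem isTotal_flatten (hτ : τ.IsTotal) (h : (L.substitution henc T).Replaces τ P) :
    P.flatten.IsTotal := by
  obtain ⟨E, hE⟩ := exists_field enc τ
  refine Set.eq_univ_of_forall fun p => ?_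
  set u := L.owner E p with hu
  have h1 : p - (L.scale : ℤ) • u ∈ L.shape (L.loc E u) := by
    rw [← owner_eq_iff, sub_add_cancel]
  exact ⟨⟨_, L.mem_tiles _⟩, (P.flatten_eq_some_iff _ _).2
    ⟨u, _, toFun_eq_of_isTotal hτ h (hE L) u, poly_eq_some_iff.2 ⟨h1, rfl⟩⟩⟩

/-- Under any field the reference cell of u belongs to the region of u, so no other polyomino of the
field can cover it. -/
theorem isTotal_of_isTotal_flatten_place {E : ℤ × ℤ → {w // w ∈ N.carrier} → Λ} {D : Set (ℤ × ℤ)}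
    (h : (L.place E D).flatten.IsTotal) (u : ℤ × ℤ) : u ∈ D := by
  obtain ⟨a, ha⟩ : (L.scale : ℤ) • u ∈ (L.place E D).flatten.dom := by rw [h]; trivial
  obtain ⟨u', π, hu', hπ⟩ := (PolyTiling.flatten_eq_some_iff _ _ _).1 ha
  obtain ⟨hD, rfl⟩ := place_eq_some_iff.1 hu'
  have h1 := (poly_eq_some_iff.1 hπ).1
  have h2 := (owner_eq_iff (L := L) E 0 u).2 (zero_mem_shape _)
  rw [← owner_eq_iff, sub_add_cancel] at h1
  rw [zero_add, h1] at h2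
  exact h2 ▸ hD

/-- Aligned copies are disjoint because a shared microtile would give both the same labels and
offset, hence the same position. If the decoded tiles at u and u + w did not stick,
`exists_common_cell` would provide such a shared cell, and w would be 0. -/
theorem exists_replaces_flatten_eq_χ (henc : Function.Injective enc) (τ' : Tiling L.tiles) :
    ∃ (τ : Tiling T) (P : PolyTiling L.tiles L.scale),
      (L.substitution henc T).Replaces τ P ∧ P.flatten = (L.substitution henc T).χ τ' := by
  let At : ℤ × ℤ → L.Know → Prop := fun u e =>
    (∃ t : {t // t ∈ T}, L.Valid enc t e) ∧ τ'.ContainsAt (L.poly e) ((L.scale : ℤ) • u)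
  have cell : ∀ {u e x}, At u e → x ∈ L.shape e →
      τ'.toFun ((L.scale : ℤ) • u + x) = some ⟨L.micro e x, L.mem_tiles _⟩ :=
    fun h hx => h.2 _ _ (poly_eq_some_iff.2 ⟨hx, rfl⟩)
  have inj : ∀ {u u' e e' x x'}, At u e → At u' e' → x ∈ L.shape e → x' ∈ L.shape e' →
      (L.scale : ℤ) • u + x = (L.scale : ℤ) • u' + x' → e = e' ∧ x = x' := by
    intro u u' e e' x x' h h' hx hx' hxx
    have h1 := cell h hx
    rw [hxx, cell h' hx', Option.some_inj, Subtype.mk.injEq] at h1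
    exact micro_inj hx h1.symm
  have uniq : ∀ u e e', At u e → At u e' → e = e' := fun u e e' h h' =>
    (inj h h' (zero_mem_shape e) (zero_mem_shape e') rfl).1
  obtain ⟨f, hf⟩ := exists_option_fun
    (r := fun u (t : {t // t ∈ T}) => ∃ e, At u e ∧ L.Valid enc t e) (by
    rintro u t t' ⟨e, h, ht⟩ ⟨e', h', ht'⟩
    obtain rfl := uniq u e e' h h'
    exact ht.unique henc ht')
  obtain ⟨g, hg⟩ := exists_option_fun (r := fun u π => ∃ e, At u e ∧ π = L.poly e) (by
    rintro u _ _ ⟨e, h, rfl⟩ ⟨e', h', rfl⟩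
    rw [uniq u e e' h h'])
  have disj : ∀ {u u' e e' x x'}, At u e → At u' e' → x ∈ L.shape e → x' ∈ L.shape e' →
      (L.scale : ℤ) • u + x = (L.scale : ℤ) • u' + x' → u = u' := by
    intro u u' e e' x x' h h' hx hx' hxx
    obtain ⟨-, rfl⟩ := inj h h' hx hx' hxx
    have h9 : (L.scale : ℤ) ≠ 0 := by exact_mod_cast L.scale_pos.ne'
    exact smul_right_injective _ h9 (add_right_cancel hxx)
  have stick : ∀ (w : {w // w ∈ N.carrier}) {u u' e e'} {t t' : {t // t ∈ T}},
      u + w.1 = u' → At u e → At u' e' → L.Valid enc t e → L.Valid enc t' e' →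
      (∀ E E' : ℤ × ℤ → {w // w ∈ N.carrier} → Λ, E 0 w ≠ E' 0 w →
        ∃ p, L.owner E p = 0 ∧ L.owner E' p = w.1) → t.1 w = t'.1 (N.opp w) := by
    intro w u u' e e' t t' hu h h' ht ht' hs
    by_contra hne
    obtain ⟨p, hp, hp'⟩ := exists_common_cell ht ht' w hs (henc.ne hne)
    have h1 := disj h h' hp hp' (by rw [← hu, smul_add]; abel)
    rw [← hu, left_eq_add] at h1
    have h2 : w.1 = (0, 0) := h1
    exact N.zero_notMem (h2 ▸ w.2)
  let τ : Tiling T := {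
    toFun := f
    sticks := by
      intro u w t t' h h'
      obtain ⟨e, he, ht⟩ := (hf _ _).1 h
      obtain ⟨e', he', ht'⟩ := (hf _ _).1 h'
      rcases L.spot w with hs | hs
      · exact stick w rfl he he' ht ht' hs
      · have := stick (N.opp w) (add_neg_cancel_right u w.1) he' he ht' ht hs
        rw [opp_opp] at this
        exact this.symm }
  let P : PolyTiling L.tiles L.scale := {
    toFun := g
    finite := by
      intro u π h
      obtain ⟨e, -, rfl⟩ := (hg _ _).1 h
      rw [dom_poly]
      exact finite_shape e
    disjoint := by
      intro u u' π π' h h' hu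
      obtain ⟨e, he, rfl⟩ := (hg _ _).1 h
      obtain ⟨e', he', rfl⟩ := (hg _ _).1 h'
      rw [dom_poly, dom_poly, Set.disjoint_left]
      rintro _ ⟨x, hx, rfl⟩ ⟨x', hx', hxx⟩
      exact hu (disj he he' hx hx' (by simpa only [add_comm] using hxx.symm))
    sticks := by
      intro u u' π π' h h' v v' a a' ha ha' w hw
      obtain ⟨e, he, rfl⟩ := (hg _ _).1 h
      obtain ⟨e', he', rfl⟩ := (hg _ _).1 h'
      refine τ'.sticks ((L.scale : ℤ) • u + v) w a a' (he.2 v a ha) ?_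
      rw [hw, add_sub_cancel]
      exact he'.2 v' a' ha' }
  refine ⟨τ, P, ⟨fun u hu => ?_, fun u t hu => ?_⟩, ?_⟩
  · refine Option.eq_none_iff_forall_ne_some.2 fun π hπ => ?_
    obtain ⟨e, he, rfl⟩ := (hg _ _).1 hπ
    obtain ⟨t, ht⟩ := he.1
    have := (hf u t).2 ⟨e, he, ht⟩
    exact Option.some_ne_none t (this.symm.trans hu)
  · obtain ⟨e, he, ht⟩ := (hf _ _).1 hu
    exact ⟨_, ⟨e, ht, rfl⟩, (hg _ _).2 ⟨e, he, rfl⟩⟩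
  · ext p : 2
    refine Option.ext fun a => ?_
    rw [PolyTiling.flatten_eq_some_iff, Substitution.χ_eq_some_iff]
    constructor
    · rintro ⟨u, π, hu, ha⟩
      obtain ⟨e, he, rfl⟩ := (hg _ _).1 hu
      obtain ⟨t, ht⟩ := he.1
      have h1 := he.2 _ _ ha
      rw [add_sub_cancel] at h1
      exact ⟨h1, t, _, ⟨e, ht, rfl⟩, u, he.2, a, ha⟩
    · rintro ⟨ha, t, _, ⟨e, ht, rfl⟩, u, he, b, hb⟩
      refine ⟨u, _, (hg _ _).2 ⟨e, ⟨⟨t, ht⟩, he⟩, rfl⟩, ?_⟩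
      have h1 := he _ _ hb
      change τ'.toFun ((L.scale : ℤ) • u + (p - (L.scale : ℤ) • u)) = some b at h1
      rw [add_sub_cancel, ha] at h1
      rw [h1]
      exact hb

end Substitution

variable (L) in
/-- The simulation of a tile system by the microtiles. -/
noncomputable def simulation (henc : Function.Injective enc) (T : Finset (Tile N X)) :
    TilingSimulation T L.tiles where
  toSubstitution := L.substitution henc T
  ψ τ := {τ' | ∃ P : PolyTiling L.tiles L.scale,
    (L.substitution henc T).Replaces τ P ∧ P.flatten = τ'}
  ψ_subset_range := by
    rintro τ _ ⟨P, hP, rfl⟩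
    exact ⟨_, Substitution.χ_flatten _ hP⟩
  ψ_nonempty τ := by
    obtain ⟨E, hE⟩ := exists_field enc τ
    exact ⟨_, _, replaces_place (hE L), rfl⟩
  ψ_poly := fun _ _ h => h
  decode τ' := by
    obtain ⟨τ, P, hP, h⟩ := exists_replaces_flatten_eq_χ (T := T) henc τ'
    refine ⟨τ, ⟨P, hP, h⟩, ?_⟩
    rintro τ₂ ⟨P₂, hP₂, h₂⟩
    exact eq_of_flatten_eq hP₂ hP (h₂.trans h.symm)

end Layout

end NbhdTiling

/-! ### The theorem -/

open NbhdTiling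
theorem mainTheorem6 {X : Type*} [Finite X] (N : Neighborhood) (T : Finset (Tile N X)) :
    ∃ (Xμ : Type) (_ : Finite Xμ) (Tμ : Finset (Tile vonNeumann Xμ))
      (S : TilingSimulation T Tμ),
      (∀ t, ∀ π ∈ S.φ t, π.IsFilledPolyomino) ∧
      ∀ τ : Tiling T,
        (τ.IsTotal ↔ ∀ τ' ∈ S.ψ τ, τ'.IsTotal) ∧
        (τ.IsTotal → ∃ τ', S.ψ τ = {τ'}) := by
  obtain ⟨n, ⟨e⟩⟩ := Finite.exists_equiv_fin X
  -- The extra label `none` makes the set of labels inhabited even when there are no glues.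
  have henc : Function.Injective fun x => some (e x) :=
    (Option.some_injective _).comp e.injective
  obtain ⟨L⟩ := exists_layout N (Option (Fin n))
  refine ⟨L.Glue, inferInstance, L.tiles, L.simulation henc T, ?_, fun τ => ⟨⟨?_, ?_⟩, ?_⟩⟩
  · rintro t _ ⟨e, -, rfl⟩
    exact Layout.isFilledPolyomino_poly e
  · rintro hτ _ ⟨P, hP, rfl⟩
    exact Layout.isTotal_flatten hτ hP
  · intro h
    obtain ⟨E, hE⟩ := Layout.exists_field (fun x => some (e x)) τ
    -- Totality of this single element of ψ τ already suffices.
    have h1 := h _ ⟨_, Layout.replaces_place (hE L), rfl⟩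
    exact Set.eq_univ_of_forall (Layout.isTotal_of_isTotal_flatten_place h1)
  · intro hτ
    obtain ⟨E, hE⟩ := Layout.exists_field (fun x => some (e x)) τ
    refine ⟨(L.place E τ.dom).flatten, ?_⟩
    refine Set.eq_singleton_iff_unique_mem.2 ⟨⟨_, Layout.replaces_place (hE L), rfl⟩, ?_⟩
    rintro _ ⟨P, hP, rfl⟩
    ext p : 2
    refine Option.ext fun a => ?_
    have h1 : P.toFun = (L.place E τ.dom).toFun := funext fun u => by
      rw [Layout.toFun_eq_of_isTotal hτ hP (hE L),
        Layout.toFun_eq_of_isTotal hτ (Layout.replaces_place (henc := henc) (hE L)) (hE L)]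
    rw [PolyTiling.flatten_eq_some_iff, PolyTiling.flatten_eq_some_iff, h1]
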